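/- Let $\Gamma$ be a connected finite compact metric graph: finitely many (at least one) compact intervals (edges) of positive length, glued together at their end points along finitely many vertices; loops and multiple edges are allowed. Let $\mathcal L(\Gamma)$ be its total length, i.e. the sum of the lengths of its edges. Let $v_1,v_2$ be vertices of $\Gamma$, let $\ell>0$, and let $\Gamma'$ be the metric graph obtained from $\Gamma$ by adding one new edge of length $\ell$ between $v_1$ and $v_2$. For a finite compact metric graph $G$ with edges $E_1,\dots,E_N$, the standard (free) Laplacian $L^{\rm st}(G)=-\frac{d^2}{dx^2}$ is the operator in $L_2(G)=\bigoplus_{n} L_2(E_n)$ whose domain consists of the functions $u\in\bigoplus_{n} W_2^2(E_n)$ that are continuous at every vertex and for which, at every vertex, the sum of the normal derivatives over all adjacent ends of edges is zero. Denote by $\lambda_0(G)\le\lambda_1(G)\le\lambda_2(G)\le\cdots$ its eigenvalues, counted with multiplicity. If $\ell>\mathcal L(\Gamma)$, then the eigenvalues $\lambda_1(\Gamma)$ and $\lambda_1(\Gamma')$ exist and satisfy $$\lambda_1(\Gamma)\ \ge\ \lambda_1(\Gamma').$$ -/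

import Mathlib

open MeasureTheory Set

noncomputable section

/-- A metric graph with vertex set `V` and edge set `E`: the edge `e` is the interval
`[0, len e]`, whose left end point is attached to the vertex `src e` and whose right end point is
attached to the vertex `tgt e`. Loops and multiple edges are allowed. The choice of an orientation
of each edge only fixes the coordinate on it. -/
structure MetricGraph (V E : Type*) where
  src : E → V
  tgt : E → V
  len : E → ℝ
  len_pos : ∀ e, 0 < len e

/-- `u` belongs to the Sobolev space `W^1_2` of the interval `[0, ℓ]` (it is absolutely continuous
with square integrable derivative) and `v` is a version of its derivative. Only the values of `u`
on `[0, ℓ]` matter, and `u` is the continuous representative of its class. -/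
def HasSobolevDeriv (ℓ : ℝ) (u v : ℝ → ℂ) : Prop :=
  MemLp v 2 (volume.restrict (Icc 0 ℓ)) ∧ ∀ x ∈ Icc 0 ℓ, u x = u 0 + ∫ t in (0 : ℝ)..x, v t

theorem HasSobolevDeriv.intervalIntegrable {ℓ : ℝ} {u v : ℝ → ℂ} (h : HasSobolevDeriv ℓ u v)
    {x : ℝ} (hx : x ∈ Icc 0 ℓ) : IntervalIntegrable v volume 0 x := by
  have h1 : IntegrableOn v (Icc 0 ℓ) volume := h.1.integrable (by norm_num)
  rw [intervalIntegrable_iff_integrableOn_Icc_of_le hx.1]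
  exact h1.mono_set (Icc_subset_Icc_right hx.2)

theorem HasSobolevDeriv.add {ℓ : ℝ} {u v u₁ v₁ : ℝ → ℂ} (h : HasSobolevDeriv ℓ u v)
    (h₁ : HasSobolevDeriv ℓ u₁ v₁) : HasSobolevDeriv ℓ (u + u₁) (v + v₁) := by
  refine ⟨h.1.add h₁.1, fun x hx => ?_⟩
  have e := intervalIntegral.integral_add (h.intervalIntegrable hx) (h₁.intervalIntegrable hx)
  simp only [Pi.add_apply, e, h.2 x hx, h₁.2 x hx]
  ring

theorem HasSobolevDeriv.smul {ℓ : ℝ} {u v : ℝ → ℂ} (c : ℂ) (h : HasSobolevDeriv ℓ u v) :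
    HasSobolevDeriv ℓ (c • u) (c • v) := by
  refine ⟨h.1.const_smul c, fun x hx => ?_⟩
  have e := intervalIntegral.integral_smul (μ := volume) (a := 0) (b := x) c v
  simp only [Pi.smul_apply, e, h.2 x hx, smul_add]

theorem HasSobolevDeriv.zero (ℓ : ℝ) : HasSobolevDeriv ℓ 0 0 :=
  ⟨MemLp.zero, fun x _ => by simp⟩

theorem HasSobolevDeriv.continuousOn {ℓ : ℝ} {u v : ℝ → ℂ} (hℓ : 0 < ℓ)
    (h : HasSobolevDeriv ℓ u v) : ContinuousOn u (Icc 0 ℓ) := by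
  have h1 : IntegrableOn v (Icc 0 ℓ) volume := h.1.integrable (by norm_num)
  have h2 : ContinuousOn (fun x => u 0 + ∫ t in (0 : ℝ)..x, v t) (Icc 0 ℓ) := by
    have := intervalIntegral.continuousOn_primitive_interval (μ := volume) (f := v)
      (a := 0) (b := ℓ) (by rwa [uIcc_of_le hℓ.le])
    rw [uIcc_of_le hℓ.le] at this
    exact continuousOn_const.add this
  exact h2.congr h.2

theorem HasSobolevDeriv.deriv_ae_zero {ℓ : ℝ} {u v : ℝ → ℂ} (hℓ : 0 < ℓ)
    (h : HasSobolevDeriv ℓ u v) (hu : u =ᵐ[volume.restrict (Icc 0 ℓ)] 0) :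
    v =ᵐ[volume.restrict (Icc 0 ℓ)] 0 := by
  have h0 : EqOn u 0 (Icc 0 ℓ) :=
    Measure.eqOn_Icc_of_ae_eq volume hℓ.ne hu (h.continuousOn hℓ) continuousOn_const
  have hint := h.intervalIntegrable (right_mem_Icc.2 hℓ.le)
  have hI : ∀ x ∈ Icc 0 ℓ, ∫ t in (0 : ℝ)..x, v t = 0 := fun x hx => by
    have h1 := h.2 x hx
    rw [h0 hx, h0 (left_mem_Icc.2 hℓ.le)] at h1
    simpa using h1.symm
  have hne : ∀ᵐ x : ℝ, x ≠ 0 ∧ x ≠ ℓ :=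
    (Measure.ae_ne volume 0).and (Measure.ae_ne volume ℓ)
  rw [Filter.EventuallyEq, ae_restrict_iff' measurableSet_Icc]
  filter_upwards [hint.ae_hasDerivAt_integral, hne] with x hx hx' hxI
  rw [uIcc_of_le hℓ.le] at hx
  have hd := hx hxI 0 (left_mem_Icc.2 hℓ.le)
  have hc : (fun y => ∫ t in (0 : ℝ)..y, v t) =ᶠ[nhds x] fun _ => (0 : ℂ) := by
    filter_upwards [Icc_mem_nhds (lt_of_le_of_ne hxI.1 hx'.1.symm) (lt_of_le_of_ne hxI.2 hx'.2)]
      with y hy using hI y hy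
  exact hd.unique ((hasDerivAt_const x (0 : ℂ)).congr_of_eventuallyEq hc)

/-- The Hilbert space `L₂(Γ)`, the orthogonal sum of the spaces `L₂` of the edges. -/
abbrev MetricGraph.L2 {V E : Type*} [Fintype E] (Γ : MetricGraph V E) : Type _ :=
  PiLp 2 fun e : E => Lp ℂ 2 ((volume : Measure ℝ).restrict (Icc 0 (Γ.len e)))

open Classical in
/-- `u` is a function on `Γ` from the domain of the standard Laplacian, and `u'`, `u''` are its
first two derivatives along the edges: `u` is in `W^2_2` on every edge, it is continuous at every
vertex, and at every vertex the sum of the normal derivatives over all adjacent ends of edges is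
zero. -/
structure MetricGraph.IsStandard {V E : Type*} [Fintype E] (Γ : MetricGraph V E)
    (u u' u'' : E → ℝ → ℂ) : Prop where
  deriv_fst : ∀ e, HasSobolevDeriv (Γ.len e) (u e) (u' e)
  deriv_snd : ∀ e, HasSobolevDeriv (Γ.len e) (u' e) (u'' e)
  continuous : ∃ c : V → ℂ, ∀ e, u e 0 = c (Γ.src e) ∧ u e (Γ.len e) = c (Γ.tgt e)
  kirchhoff : ∀ v : V, ∑ e, ((if Γ.src e = v then u' e 0 else 0)
    - (if Γ.tgt e = v then u' e (Γ.len e) else 0)) = 0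

/-- The graph `{(f, L f)}` of the standard Laplacian `L f = - f''`. -/
def MetricGraph.laplacianGraph {V E : Type*} [Fintype E] (Γ : MetricGraph V E) :
    Submodule ℂ (Γ.L2 × Γ.L2) where
  carrier := {p | ∃ u u' u'' : E → ℝ → ℂ, Γ.IsStandard u u' u'' ∧ ∀ e,
    p.1 e =ᵐ[volume.restrict (Icc 0 (Γ.len e))] u e ∧
    p.2 e =ᵐ[volume.restrict (Icc 0 (Γ.len e))] -u'' e}
  zero_mem' := by
    refine ⟨0, 0, 0, ⟨fun _ => .zero _, fun _ => .zero _, ⟨0, by simp⟩, by simp⟩, fun e => ?_⟩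
    constructor
    · simpa using Lp.coeFn_zero ℂ 2 (volume.restrict (Icc 0 (Γ.len e)))
    · simpa using Lp.coeFn_zero ℂ 2 (volume.restrict (Icc 0 (Γ.len e)))
  add_mem' := by
    rintro p q ⟨u, u', u'', ⟨h1, h2, ⟨c, hc⟩, h3⟩, h⟩ ⟨w, w', w'', ⟨k1, k2, ⟨d, hd⟩, k3⟩, k⟩
    refine ⟨u + w, u' + w', u'' + w'', ⟨fun e => (h1 e).add (k1 e), fun e => (h2 e).add (k2 e),
      ⟨c + d, fun e => ?_⟩, fun v => ?_⟩, fun e => ⟨?_, ?_⟩⟩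
    · simp [(hc e).1, (hc e).2, (hd e).1, (hd e).2]
    · have := congrArg₂ (· + ·) (h3 v) (k3 v)
      simp only [← Finset.sum_add_distrib, add_zero] at this
      refine Eq.trans (Finset.sum_congr rfl fun e _ => ?_) this
      simp only [Pi.add_apply]
      split_ifs <;> ring
    · filter_upwards [Lp.coeFn_add (p.1 e) (q.1 e), (h e).1, (k e).1] with x a1 a2 a3
      simpa [a2, a3] using a1
    · filter_upwards [Lp.coeFn_add (p.2 e) (q.2 e), (h e).2, (k e).2] with x a1 a2 a3
      simpa [a2, a3, add_comm] using a1
  smul_mem' := by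
    rintro a p ⟨u, u', u'', ⟨h1, h2, ⟨c, hc⟩, h3⟩, h⟩
    refine ⟨a • u, a • u', a • u'', ⟨fun e => (h1 e).smul a, fun e => (h2 e).smul a,
      ⟨a • c, fun e => ?_⟩, fun v => ?_⟩, fun e => ⟨?_, ?_⟩⟩
    · simp [(hc e).1, (hc e).2]
    · have := congrArg (a * ·) (h3 v)
      simp only [Finset.mul_sum, mul_zero] at this
      refine Eq.trans (Finset.sum_congr rfl fun e _ => ?_) this
      simp only [Pi.smul_apply, smul_eq_mul]
      split_ifs <;> ring
    · filter_upwards [Lp.coeFn_smul a (p.1 e), (h e).1] with x a1 a2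
      simpa [a2] using a1
    · filter_upwards [Lp.coeFn_smul a (p.2 e), (h e).2] with x a1 a2
      simpa [a2] using a1

theorem MetricGraph.laplacianGraph_snd_eq_zero {V E : Type*} [Fintype E] (Γ : MetricGraph V E)
    (p : Γ.L2 × Γ.L2) (hp : p ∈ Γ.laplacianGraph) (h0 : p.1 = 0) : p.2 = 0 := by
  obtain ⟨u, u', u'', hu, h⟩ := hp
  ext e : 1
  have hz : ((0 : Lp ℂ 2 (volume.restrict (Icc 0 (Γ.len e)))) : ℝ → ℂ)
      =ᵐ[volume.restrict (Icc 0 (Γ.len e))] 0 := Lp.coeFn_zero ℂ 2 _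
  have h1 : u e =ᵐ[volume.restrict (Icc 0 (Γ.len e))] 0 := by
    have := (h e).1
    rw [h0] at this
    exact this.symm.trans hz
  have h2 := (hu.deriv_fst e).deriv_ae_zero (Γ.len_pos e) h1
  have h3 := (hu.deriv_snd e).deriv_ae_zero (Γ.len_pos e) h2
  refine Lp.ext ?_
  filter_upwards [(h e).2, h3, hz] with x a1 a2 a3
  rw [a1]
  simp only [Pi.neg_apply, a2, Pi.zero_apply, neg_zero]
  exact a3.symm

/-- The standard (free) Laplacian of `Γ`, as an unbounded operator in `L₂(Γ)`. -/
def MetricGraph.laplacian {V E : Type*} [Fintype E] (Γ : MetricGraph V E) :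
    Γ.L2 →ₗ.[ℂ] Γ.L2 :=
  Γ.laplacianGraph.toLinearPMap

theorem MetricGraph.graph_laplacian {V E : Type*} [Fintype E] (Γ : MetricGraph V E) :
    Γ.laplacian.graph = Γ.laplacianGraph :=
  Submodule.toLinearPMap_graph_eq _ Γ.laplacianGraph_snd_eq_zero

/-- The eigenspace `{f ∈ dom L | L f = μ f}` of the standard Laplacian. -/
def MetricGraph.eigenspace {V E : Type*} [Fintype E] (Γ : MetricGraph V E) (μ : ℝ) :
    Submodule ℂ Γ.L2 :=
  (LinearMap.ker (Γ.laplacian.toFun - (μ : ℂ) • Γ.laplacian.domain.subtype)).map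
    Γ.laplacian.domain.subtype

theorem MetricGraph.mem_eigenspace {V E : Type*} [Fintype E] (Γ : MetricGraph V E) (μ : ℝ)
    (f : Γ.L2) : f ∈ Γ.eigenspace μ ↔
      ∃ h : f ∈ Γ.laplacian.domain, Γ.laplacian ⟨f, h⟩ = (μ : ℂ) • f := by
  simp only [eigenspace, Submodule.mem_map, LinearMap.mem_ker, LinearMap.sub_apply,
    LinearMap.smul_apply, sub_eq_zero]
  constructor
  · rintro ⟨g, hg, rfl⟩
    exact ⟨g.2, hg⟩
  · rintro ⟨h, hf⟩
    exact ⟨⟨f, h⟩, hf, rfl⟩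

/-- `μ` is the eigenvalue `λ_n` of the standard Laplacian, where the eigenvalues
`λ_0 ≤ λ_1 ≤ λ_2 ≤ …` are counted with their multiplicities: `μ` is the least real number such that
the eigenspaces to eigenvalues `≤ μ` have total dimension at least `n + 1`. -/
def MetricGraph.IsNthEigenvalue {V E : Type*} [Fintype E] (Γ : MetricGraph V E) (n : ℕ) (μ : ℝ) :
    Prop :=
  IsLeast {ν : ℝ | (n : Cardinal) + 1 ≤
    Module.rank ℂ (⨆ κ : {κ : ℝ // κ ≤ ν}, Γ.eigenspace κ : Submodule ℂ Γ.L2)} μ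

/-- `Γ` is connected: it has a vertex, and any two vertices are joined by a path of edges. -/
def MetricGraph.Connected {V E : Type*} (Γ : MetricGraph V E) : Prop :=
  (SimpleGraph.fromRel fun v w => ∃ e, Γ.src e = v ∧ Γ.tgt e = w).Connected

/-- The total length of `Γ`. -/
def MetricGraph.totalLength {V E : Type*} [Fintype E] (Γ : MetricGraph V E) : ℝ := ∑ e, Γ.len e

/-- The graph obtained from `Γ` by adding an edge of length `ℓ` between the vertices `v₁`, `v₂`;
the new edge is `none`. -/
def MetricGraph.addEdge {V E : Type*} (Γ : MetricGraph V E) (v₁ v₂ : V) (ℓ : ℝ) (hℓ : 0 < ℓ) :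
    MetricGraph V (Option E) where
  src e := e.elim v₁ Γ.src
  tgt e := e.elim v₂ Γ.tgt
  len e := e.elim ℓ Γ.len
  len_pos e := by
    cases e with
    | none => exact hℓ
    | some e => exact Γ.len_pos e

end

/-! By the variational principle, $\lambda_1$ of a graph is the minimum of $\|u'\|^2/\|u\|^2$ over
nonzero $W^1_2$ functions that are continuous at the vertices and have mean value zero. An
eigenfunction $u$ of $\Gamma$ for $\mu=\lambda_1(\Gamma)$ is extended to the new edge by
$s-d\cos(\pi x/\ell)$, where $s$ and $d$ are the half sum and half difference of its end values
$u(v_1),u(v_2)$. The cosine part has mean value zero on the new edge, adds $A=\frac{\ell}{2}|d|^2$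
to the squared norm and $(\pi/\ell)^2A$ to the energy. The constant $s$ adds $\ell|s|^2$ to the
squared norm and no energy. Projecting off the constants on $\Gamma'$ removes
$\ell^2|s|^2/(\ell+\mathcal L)\le\ell|s|^2$. Hence
$\lambda_1(\Gamma')(\|u\|^2+A)\le\mu\|u\|^2+(\pi/\ell)^2A$, and everything follows once
$(\pi/\ell)^2\le\mu$.

This last bound is where $\ell>\mathcal L(\Gamma)$ enters. A connected graph has a closed walk using
each edge once in each direction (`Connected.exists_closed_walk`). Reading $u$ along it gives a
periodic function on an interval of length $2\mathcal L$, with mean value zero and with doubled norm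
and energy (`IsWalk.exists_sobolev`). Wirtinger's inequality (`wirtinger_complex`) then bounds the
Rayleigh quotient below by $\kappa^2$ for every $0\le\kappa<\pi/\mathcal L$, in particular for
$\kappa=\pi/\ell$.

The variational principle rests on three facts: the minimum is attained, by compactness of $W^1_2$
in $L_2$ (`exists_isGapMinimizer`); a minimizer is a weak, hence genuine, eigenfunction
(`exists_isStandard_of_weak`); eigenfunctions for smaller eigenvalues are constant
(`IsGapMinimizer.eigenspace_le_span_one`). -/

noncomputable section

/-! ### Calculus of Sobolev functions on an interval -/

/-- Integration by parts for primitives of integrable real functions. -/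
theorem integral_primitive_mul_add_mul_primitive {v w : ℝ → ℝ} {a b : ℝ} (α β : ℝ)
    (hv : IntervalIntegrable v volume a b) (hw : IntervalIntegrable w volume a b) :
    ∫ x in a..b, (v x * (β + ∫ t in a..x, w t) + (α + ∫ t in a..x, v t) * w x) =
      (α + ∫ t in a..b, v t) * (β + ∫ t in a..b, w t) - α * β := by
  have hac {g : ℝ → ℝ} (γ : ℝ) (hg : IntervalIntegrable g volume a b) :
      AbsolutelyContinuousOnInterval (fun x => γ + ∫ t in a..x, g t) a b :=
    (contDiff_const (c := γ)).contDiffOn.absolutelyContinuousOnInterval.fun_add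
      (hg.absolutelyContinuousOnInterval_intervalIntegral left_mem_uIcc)
  have key := (hac α hv).integral_deriv_mul_eq_sub (hac β hw)
  simp only [intervalIntegral.integral_same, add_zero] at key
  rw [← key]
  refine intervalIntegral.integral_congr_ae ?_
  filter_upwards [hv.ae_hasDerivAt_integral, hw.ae_hasDerivAt_integral] with x h1 h2 hx
  have hx' := uIoc_subset_uIcc hx
  rw [((h1 hx' a left_mem_uIcc).const_add α).deriv, ((h2 hx' a left_mem_uIcc).const_add β).deriv]

namespace HasSobolevDeriv

variable {ℓ : ℝ} {u v w z : ℝ → ℂ}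

theorem mono {ℓ' : ℝ} (h : HasSobolevDeriv ℓ u v) (hℓ : ℓ' ≤ ℓ) : HasSobolevDeriv ℓ' u v :=
  ⟨h.1.mono_measure (Measure.restrict_mono (Icc_subset_Icc_right hℓ) le_rfl),
    fun x hx => h.2 x ⟨hx.1, hx.2.trans hℓ⟩⟩

theorem congr {u₁ v₁ : ℝ → ℂ} (h : HasSobolevDeriv ℓ u v) (hu : EqOn u₁ u (Icc 0 ℓ))
    (hv : v₁ =ᵐ[volume.restrict (Icc 0 ℓ)] v) : HasSobolevDeriv ℓ u₁ v₁ := by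
  refine ⟨(memLp_congr_ae hv).2 h.1, fun x hx => ?_⟩
  rw [hu hx, hu ⟨le_rfl, hx.1.trans hx.2⟩, h.2 x hx]
  congr 1
  refine intervalIntegral.integral_congr_ae ?_
  have := (ae_restrict_iff' measurableSet_Icc).1 hv
  filter_upwards [this] with t ht htx
  rw [uIoc_of_le hx.1] at htx
  exact (ht ⟨htx.1.le, htx.2.trans hx.2⟩).symm

theorem const (ℓ : ℝ) (c : ℂ) : HasSobolevDeriv ℓ (fun _ => c) 0 :=
  ⟨MemLp.zero, fun x _ => by simp⟩

/-- A continuous real-linear map commutes with the weak derivative. -/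
theorem clm_comp (L : ℂ →L[ℝ] ℂ) (h : HasSobolevDeriv ℓ u v) :
    HasSobolevDeriv ℓ (fun x => L (u x)) (fun x => L (v x)) := by
  refine ⟨L.comp_memLp' h.1, fun x hx => ?_⟩
  simp only [h.2 x hx, map_add]
  rw [L.intervalIntegral_comp_comm (h.intervalIntegrable hx)]

theorem conj (h : HasSobolevDeriv ℓ u v) :
    HasSobolevDeriv ℓ (fun x => starRingEnd ℂ (u x)) (fun x => starRingEnd ℂ (v x)) :=
  h.clm_comp (Complex.conjCLE : ℂ →L[ℝ] ℂ)

theorem re (h : HasSobolevDeriv ℓ u v) :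
    HasSobolevDeriv ℓ (fun x => ((u x).re : ℂ)) (fun x => ((v x).re : ℂ)) :=
  h.clm_comp (Complex.ofRealCLM.comp Complex.reCLM)

theorem im (h : HasSobolevDeriv ℓ u v) :
    HasSobolevDeriv ℓ (fun x => ((u x).im : ℂ)) (fun x => ((v x).im : ℂ)) :=
  h.clm_comp (Complex.ofRealCLM.comp Complex.imCLM)

theorem of_hasDerivAt (hd : ∀ x, HasDerivAt u (v x) x) (hv : Continuous v) :
    HasSobolevDeriv ℓ u v := by
  refine ⟨?_, fun x _ => ?_⟩
  · obtain ⟨C, hC⟩ := (isCompact_Icc (a := (0 : ℝ)) (b := ℓ)).exists_bound_of_continuousOn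
      hv.continuousOn
    exact MemLp.of_bound hv.aestronglyMeasurable C (ae_restrict_of_forall_mem measurableSet_Icc hC)
  · rw [intervalIntegral.integral_eq_sub_of_hasDerivAt (fun y _ => hd y)
      (hv.intervalIntegrable _ _)]
    ring

theorem continuousOn' (h : HasSobolevDeriv ℓ u v) : ContinuousOn u (Icc 0 ℓ) := by
  rcases lt_trichotomy 0 ℓ with hℓ | rfl | hℓ
  · exact h.continuousOn hℓ
  · simp
  · simp [Icc_eq_empty_of_lt hℓ]

theorem memLp_top (h : HasSobolevDeriv ℓ u v) : MemLp u ⊤ (volume.restrict (Icc 0 ℓ)) := by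
  obtain ⟨C, hC⟩ := isCompact_Icc.exists_bound_of_continuousOn h.continuousOn'
  exact memLp_top_of_bound (h.continuousOn'.aestronglyMeasurable measurableSet_Icc) C
    (ae_restrict_of_forall_mem measurableSet_Icc hC)

theorem memLp (h : HasSobolevDeriv ℓ u v) : MemLp u 2 (volume.restrict (Icc 0 ℓ)) :=
  h.memLp_top.mono_exponent le_top

/-- Integration by parts for real valued functions. -/
theorem integral_mul_add_mul_of_real {p q p' q' : ℝ → ℝ} (hℓ : 0 ≤ ℓ)
    (h : HasSobolevDeriv ℓ (fun x => (p x : ℂ)) fun x => (p' x : ℂ))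
    (k : HasSobolevDeriv ℓ (fun x => (q x : ℂ)) fun x => (q' x : ℂ)) :
    IntervalIntegrable (fun x => p' x * q x + p x * q' x) volume 0 ℓ ∧
    ∫ x in 0..ℓ, (p' x * q x + p x * q' x) = p ℓ * q ℓ - p 0 * q 0 := by
  have hint {r r' : ℝ → ℝ} (h : HasSobolevDeriv ℓ (fun x => (r x : ℂ)) fun x => (r' x : ℂ)) :
      IntervalIntegrable r' volume 0 ℓ ∧ ContinuousOn r (Icc 0 ℓ) ∧
        ∀ x ∈ Icc 0 ℓ, r x = r 0 + ∫ t in 0..x, r' t := by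
    refine ⟨?_, ?_, fun x hx => ?_⟩
    · have := h.intervalIntegrable (right_mem_Icc.2 hℓ)
      have h2 := (intervalIntegrable_iff.1 this).re
      exact intervalIntegrable_iff.2 h2
    · have := Complex.continuous_re.comp_continuousOn h.continuousOn'
      simpa [Function.comp_def] using this
    · have := h.2 x hx
      simp only [intervalIntegral.integral_ofReal] at this
      exact_mod_cast this
  obtain ⟨i1, c1, e1⟩ := hint h
  obtain ⟨i2, c2, e2⟩ := hint k
  rw [← uIcc_of_le hℓ] at c1 c2
  refine ⟨(i1.mul_continuousOn c2).add (i2.continuousOn_mul c1), ?_⟩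
  have key := integral_primitive_mul_add_mul_primitive (p 0) (q 0) i1 i2
  rw [← e1 ℓ (right_mem_Icc.2 hℓ), ← e2 ℓ (right_mem_Icc.2 hℓ)] at key
  rw [← key]
  refine intervalIntegral.integral_congr fun x hx => ?_
  rw [uIcc_of_le hℓ] at hx
  simp only [← e1 x hx, ← e2 x hx]

/-- Integration by parts. -/
theorem integral_mul_add_mul (hℓ : 0 ≤ ℓ) (h : HasSobolevDeriv ℓ u v)
    (k : HasSobolevDeriv ℓ w z) :
    ∫ x in 0..ℓ, (v x * w x + u x * z x) = u ℓ * w ℓ - u 0 * w 0 := by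
  obtain ⟨i1, e1⟩ := integral_mul_add_mul_of_real hℓ h.re k.re
  obtain ⟨i2, e2⟩ := integral_mul_add_mul_of_real hℓ h.im k.im
  obtain ⟨i3, e3⟩ := integral_mul_add_mul_of_real hℓ h.re k.im
  obtain ⟨i4, e4⟩ := integral_mul_add_mul_of_real hℓ h.im k.re
  have hs : ∀ x, v x * w x + u x * z x =
      (((((v x).re * (w x).re + (u x).re * (z x).re) -
        ((v x).im * (w x).im + (u x).im * (z x).im) : ℝ) : ℂ)) +
      (((((v x).re * (w x).im + (u x).re * (z x).im) +
        ((v x).im * (w x).re + (u x).im * (z x).re) : ℝ) : ℂ)) * Complex.I := by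
    intro x
    apply Complex.ext <;> simp <;> ring
  simp only [hs]
  rw [intervalIntegral.integral_add, intervalIntegral.integral_mul_const,
    intervalIntegral.integral_ofReal, intervalIntegral.integral_ofReal,
    intervalIntegral.integral_sub i1 i2, intervalIntegral.integral_add i3 i4, e1, e2, e3, e4]
  · apply Complex.ext <;> simp <;> ring
  · exact (intervalIntegrable_iff.2 (intervalIntegrable_iff.1 (i1.sub i2)).ofReal)
  · exact IntervalIntegrable.mul_const
      (intervalIntegrable_iff.2 (intervalIntegrable_iff.1 (i3.add i4)).ofReal) _

theorem mul (h : HasSobolevDeriv ℓ u v) (k : HasSobolevDeriv ℓ w z) :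
    HasSobolevDeriv ℓ (fun x => u x * w x) (fun x => v x * w x + u x * z x) := by
  refine ⟨(k.memLp_top.mul h.1).add (k.1.mul h.memLp_top), fun x hx => ?_⟩
  rw [(h.mono hx.2).integral_mul_add_mul hx.1 (k.mono hx.2)]
  ring

theorem integral_Icc_eq (hℓ : 0 ≤ ℓ) {F : Type*} [NormedAddCommGroup F] [NormedSpace ℝ F]
    (f : ℝ → F) : ∫ x in Icc 0 ℓ, f x = ∫ x in 0..ℓ, f x := by
  rw [intervalIntegral.integral_of_le hℓ, integral_Icc_eq_integral_Ioc]

/-- The integral of the concatenation of two functions. -/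
theorem _root_.intervalIntegral_concat {F : Type*} [NormedAddCommGroup F] [NormedSpace ℝ F]
    {a b : ℝ} (ha : 0 ≤ a) (hb : 0 ≤ b) {f g : ℝ → F} (hf : IntervalIntegrable f volume 0 a)
    (hg : IntervalIntegrable g volume 0 b) :
    IntervalIntegrable (fun x => if x ≤ a then f x else g (x - a)) volume 0 (a + b) ∧
    ∫ x in 0..(a + b), (if x ≤ a then f x else g (x - a)) =
      (∫ x in 0..a, f x) + ∫ x in 0..b, g x := by
  have e1 : EqOn (fun x => if x ≤ a then f x else g (x - a)) f (uIoc 0 a) := by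
    intro x hx
    rw [uIoc_of_le ha] at hx
    simp [hx.2]
  have e2 : EqOn (fun x => if x ≤ a then f x else g (x - a)) (fun x => g (x - a))
      (uIoc a (a + b)) := by
    intro x hx
    rw [uIoc_of_le (by linarith)] at hx
    simp [hx.1]
  have hg' : IntervalIntegrable (fun x => g (x - a)) volume a (a + b) := by
    have := hg.comp_sub_right a
    simpa [add_comm] using this
  have i1 := (intervalIntegrable_congr e1).2 hf
  have i2 := (intervalIntegrable_congr e2).2 hg'
  refine ⟨i1.trans i2, ?_⟩
  rw [← intervalIntegral.integral_add_adjacent_intervals i1 i2,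
    intervalIntegral.integral_congr_ae (Filter.Eventually.of_forall fun x hx => e1 hx),
    intervalIntegral.integral_congr_ae (Filter.Eventually.of_forall fun x hx => e2 hx),
    intervalIntegral.integral_comp_sub_right]
  simp

theorem intervalIntegrable_norm_sq (hℓ : 0 ≤ ℓ) (h : MemLp v 2 (volume.restrict (Icc 0 ℓ))) :
    IntervalIntegrable (fun x => ‖v x‖ ^ 2) volume 0 ℓ := by
  rw [intervalIntegrable_iff_integrableOn_Icc_of_le hℓ]
  exact h.integrable_norm_pow (by norm_num)

/-- For $W^1_2$ it is enough that the values match at the junction; the derivative may jump there.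
This is what allows a function to be read off along a walk that turns at vertices. -/
theorem concat {a b : ℝ} (ha : 0 ≤ a) (h : HasSobolevDeriv a u v)
    (k : HasSobolevDeriv b w z) (huw : u a = w 0) :
    HasSobolevDeriv (a + b) (fun x => if x ≤ a then u x else w (x - a))
      (fun x => if x ≤ a then v x else z (x - a)) := by
  constructor
  · have h1 : MemLp v 2 ((volume.restrict (Icc 0 (a + b))).restrict (Iic a)) := by
      rw [Measure.restrict_restrict measurableSet_Iic]
      have hs : Iic a ∩ Icc 0 (a + b) ⊆ Icc 0 a := fun x hx => ⟨hx.2.1, hx.1⟩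
      exact h.1.mono_measure (Measure.restrict_mono hs le_rfl)
    have h2 : MemLp (fun x => z (x - a)) 2
        ((volume.restrict (Icc 0 (a + b))).restrict (Iic a)ᶜ) := by
      have hp : MeasurePreserving (fun x : ℝ => x - a) (volume.restrict (Icc a (a + b)))
          (volume.restrict (Icc 0 b)) := by
        have := (measurePreserving_sub_right (volume : Measure ℝ) a).restrict_preimage
          (s := Icc 0 b) measurableSet_Icc
        simpa [add_comm] using this
      rw [Measure.restrict_restrict measurableSet_Iic.compl]
      have hs : (Iic a)ᶜ ∩ Icc 0 (a + b) ⊆ Icc a (a + b) := fun x hx =>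
        ⟨(not_le.1 (show ¬ x ≤ a from hx.1)).le, hx.2.2⟩
      exact (k.1.comp_measurePreserving hp).mono_measure (Measure.restrict_mono hs le_rfl)
    have := MemLp.piecewise (s := Iic a) measurableSet_Iic h1 h2
    refine (memLp_congr_ae (ae_of_all _ fun x => ?_)).1 this
    by_cases hx : x ≤ a <;> simp [Set.piecewise, hx]
  · intro x hx
    have h0 : (if (0 : ℝ) ≤ a then u 0 else w (0 - a)) = u 0 := by simp [ha]
    by_cases hxa : x ≤ a
    · simp only [hxa, if_true, ha]
      rw [h.2 x ⟨hx.1, hxa⟩]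
      congr 1
      refine intervalIntegral.integral_congr fun t ht => ?_
      rw [uIcc_of_le hx.1] at ht
      simp [ht.2.trans hxa]
    · push Not at hxa
      have hx' : x - a ∈ Icc 0 b := ⟨by linarith, by linarith [hx.2]⟩
      have := (intervalIntegral_concat ha hx'.1 (h.intervalIntegrable (right_mem_Icc.2 ha))
        (k.intervalIntegrable hx')).2
      rw [add_sub_cancel] at this
      simp only [hxa.not_ge, if_false, ha, if_true, this]
      rw [← add_assoc, ← h.2 a (right_mem_Icc.2 ha), huw, ← k.2 _ hx']

theorem reverse (hℓ : 0 ≤ ℓ) (h : HasSobolevDeriv ℓ u v) :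
    HasSobolevDeriv ℓ (fun x => u (ℓ - x)) (fun x => -v (ℓ - x)) := by
  constructor
  · have hp : MeasurePreserving (fun x : ℝ => ℓ - x) (volume.restrict (Icc 0 ℓ))
        (volume.restrict (Icc 0 ℓ)) := by
      have := (Measure.measurePreserving_sub_left (volume : Measure ℝ) ℓ).restrict_preimage
        (s := Icc 0 ℓ) measurableSet_Icc
      simpa using this
    exact (h.1.comp_measurePreserving hp).neg
  · intro x hx
    have hx' : ℓ - x ∈ Icc 0 ℓ := ⟨by linarith [hx.2], by linarith [hx.1]⟩
    have e : ∫ t in 0..x, -v (ℓ - t) = - ∫ t in (ℓ - x)..ℓ, v t := by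
      rw [intervalIntegral.integral_neg, intervalIntegral.integral_comp_sub_left]
      simp
    have hi := h.intervalIntegrable hx'
    have hj := h.intervalIntegrable (right_mem_Icc.2 hℓ)
    have := intervalIntegral.integral_interval_sub_left hj hi
    simp only [e, ← this, sub_zero]
    rw [h.2 _ hx', h.2 ℓ (right_mem_Icc.2 hℓ)]
    ring

end HasSobolevDeriv

/-! ### Compactness of the embedding of $W^1_2$ of an interval into $L_2$ -/

open scoped BoundedContinuousFunction in
/-- A continuous function on an interval as an element of `L₂`. -/
def continuousToL2 (ℓ : ℝ) (hℓ : 0 ≤ ℓ) (φ : Icc 0 ℓ →ᵇ ℂ) :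
    Lp ℂ 2 ((volume : Measure ℝ).restrict (Icc 0 ℓ)) :=
  MemLp.toLp (IccExtend hℓ φ)
    (MemLp.of_bound (φ.continuous.Icc_extend' (h := hℓ)).aestronglyMeasurable ‖φ‖
      (ae_of_all _ fun _ => φ.norm_coe_le_norm _))

/-- Carries compact sets for the sup norm, as provided by Arzelà–Ascoli, to compact sets of `L₂`. -/
theorem continuous_continuousToL2 (ℓ : ℝ) (hℓ : 0 ≤ ℓ) : Continuous (continuousToL2 ℓ hℓ) := by
  refine (LipschitzWith.of_dist_le_mul
    (K := (measureUnivNNReal ((volume : Measure ℝ).restrict (Icc 0 ℓ))) ^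
      (2 : ENNReal).toReal⁻¹) fun φ ψ => ?_).continuous
  rw [dist_eq_norm, dist_eq_norm, continuousToL2, continuousToL2, ← MemLp.toLp_sub]
  refine Lp.norm_le_of_ae_bound (norm_nonneg _) ?_
  filter_upwards [MemLp.coeFn_toLp ((MemLp.of_bound
    (φ.continuous.Icc_extend' (h := hℓ)).aestronglyMeasurable ‖φ‖
      (ae_of_all _ fun _ => φ.norm_coe_le_norm _)).sub (MemLp.of_bound
    (ψ.continuous.Icc_extend' (h := hℓ)).aestronglyMeasurable ‖ψ‖
      (ae_of_all _ fun _ => ψ.norm_coe_le_norm _)))] with x hx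
  rw [hx]
  exact (φ - ψ).norm_coe_le_norm _

/-- Cauchy–Schwarz against the indicator function of `Ioc x y`, whose norm is `√(y - x)`. -/
theorem norm_intervalIntegral_le_sqrt_mul {ℓ : ℝ}
    (f : Lp ℂ 2 ((volume : Measure ℝ).restrict (Icc 0 ℓ))) {x y : ℝ} (hx : 0 ≤ x) (hxy : x ≤ y)
    (hy : y ≤ ℓ) : ‖∫ t in x..y, f t‖ ≤ √(y - x) * ‖f‖ := by
  have hsub : Ioc x y ⊆ Icc 0 ℓ := fun t ht => ⟨hx.trans ht.1.le, ht.2.trans hy⟩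
  have e : ∫ t in x..y, f t = ∫ t in Ioc x y, f t ∂(volume.restrict (Icc 0 ℓ)) := by
    rw [intervalIntegral.integral_of_le hxy, Measure.restrict_restrict measurableSet_Ioc,
      inter_eq_self_of_subset_left hsub]
  have hμ : ((volume : Measure ℝ).restrict (Icc 0 ℓ)).real (Ioc x y) = y - x := by
    rw [measureReal_restrict_apply measurableSet_Ioc, inter_eq_self_of_subset_left hsub]
    simp [hxy]
  rw [e, ← L2.inner_indicatorConstLp_one (𝕜 := ℂ) measurableSet_Ioc (measure_ne_top _ _)]
  refine (norm_inner_le_norm _ _).trans (le_of_eq ?_)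
  rw [norm_indicatorConstLp (by norm_num) (by norm_num), hμ, Real.sqrt_eq_rpow]
  simp

namespace HasSobolevDeriv

variable {ℓ : ℝ} {u v : ℝ → ℂ}

theorem integral_eq_sub (h : HasSobolevDeriv ℓ u v) {x y : ℝ} (hx : x ∈ Icc 0 ℓ)
    (hy : y ∈ Icc 0 ℓ) : ∫ t in x..y, v t = u y - u x := by
  rw [← intervalIntegral.integral_interval_sub_left (h.intervalIntegrable hy)
    (h.intervalIntegrable hx), h.2 x hx, h.2 y hy]
  ring

theorem intervalIntegral_congr_ae_restrict {f g : ℝ → ℂ}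
    (h : f =ᵐ[volume.restrict (Icc 0 ℓ)] g) {x y : ℝ} (hx : x ∈ Icc 0 ℓ) (hy : y ∈ Icc 0 ℓ) :
    ∫ t in x..y, f t = ∫ t in x..y, g t := by
  refine intervalIntegral.integral_congr_ae ?_
  filter_upwards [(ae_restrict_iff' measurableSet_Icc).1 h] with t ht htx
  exact ht (uIcc_subset_Icc hx hy (uIoc_subset_uIcc htx))

theorem norm_sub_le (h : HasSobolevDeriv ℓ u v)
    {g : Lp ℂ 2 ((volume : Measure ℝ).restrict (Icc 0 ℓ))}
    (hg : g =ᵐ[volume.restrict (Icc 0 ℓ)] v) {x y : ℝ} (hx : x ∈ Icc 0 ℓ) (hy : y ∈ Icc 0 ℓ) :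
    ‖u x - u y‖ ≤ √|x - y| * ‖g‖ := by
  wlog hxy : x ≤ y generalizing x y
  · rw [norm_sub_rev, abs_sub_comm]
    exact this hy hx (le_of_not_ge hxy)
  rw [norm_sub_rev, ← h.integral_eq_sub hx hy, ← intervalIntegral_congr_ae_restrict hg hx hy,
    abs_sub_comm, abs_of_nonneg (sub_nonneg.2 hxy)]
  exact norm_intervalIntegral_le_sqrt_mul g hx.1 hxy hy.2

/-- Averaging `u x = u y + (u x - u y)` over `y`: Cauchy–Schwarz handles the first term, the Hölder
estimate `norm_sub_le` the second. -/
theorem norm_le (hℓ : 0 < ℓ) (h : HasSobolevDeriv ℓ u v)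
    {f g : Lp ℂ 2 ((volume : Measure ℝ).restrict (Icc 0 ℓ))}
    (hf : f =ᵐ[volume.restrict (Icc 0 ℓ)] u) (hg : g =ᵐ[volume.restrict (Icc 0 ℓ)] v)
    {x : ℝ} (hx : x ∈ Icc 0 ℓ) : ‖u x‖ ≤ √ℓ / ℓ * ‖f‖ + √ℓ * ‖g‖ := by
  have hc := h.continuousOn'
  have h0 : (0 : ℝ) ∈ Icc 0 ℓ := left_mem_Icc.2 hℓ.le
  have h1 : ℓ ∈ Icc 0 ℓ := right_mem_Icc.2 hℓ.le
  have hi : IntervalIntegrable u volume 0 ℓ := by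
    rw [← uIcc_of_le hℓ.le] at hc
    exact hc.intervalIntegrable
  have e : (ℓ : ℂ) * u x = (∫ y in 0..ℓ, f y) + ∫ y in 0..ℓ, (u x - u y) := by
    rw [intervalIntegral_congr_ae_restrict hf h0 h1, intervalIntegral.integral_sub (by simp) hi,
      intervalIntegral.integral_const]
    simp
  have b1 := norm_intervalIntegral_le_sqrt_mul f le_rfl hℓ.le le_rfl
  have b2 : ‖∫ y in 0..ℓ, (u x - u y)‖ ≤ √ℓ * ‖g‖ * |ℓ - 0| := by
    refine intervalIntegral.norm_integral_le_of_norm_le_const fun y hy => ?_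
    rw [uIoc_of_le hℓ.le] at hy
    refine (h.norm_sub_le hg hx ⟨hy.1.le, hy.2⟩).trans ?_
    gcongr
    rw [abs_le]
    constructor <;> linarith [hx.1, hx.2, hy.1, hy.2]
  rw [sub_zero] at b1
  rw [sub_zero, abs_of_pos hℓ] at b2
  have b3 : ℓ * ‖u x‖ ≤ √ℓ * ‖f‖ + √ℓ * ‖g‖ * ℓ := by
    calc ℓ * ‖u x‖ = ‖(ℓ : ℂ) * u x‖ := by simp [abs_of_pos hℓ]
      _ ≤ _ := by rw [e]; exact (norm_add_le _ _).trans (add_le_add b1 b2)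
  have e3 : √ℓ / ℓ * ‖f‖ + √ℓ * ‖g‖ = (√ℓ * ‖f‖ + √ℓ * ‖g‖ * ℓ) / ℓ := by field_simp
  rw [e3, le_div_iff₀ hℓ]
  linarith

/-- The embedding of the Sobolev space of an interval into `L₂` is compact. -/
theorem exists_isCompact (hℓ : 0 < ℓ) (R : ℝ) :
    ∃ K : Set (Lp ℂ 2 ((volume : Measure ℝ).restrict (Icc 0 ℓ))), IsCompact K ∧
      ∀ (u v : ℝ → ℂ) (f g : Lp ℂ 2 ((volume : Measure ℝ).restrict (Icc 0 ℓ))),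
        HasSobolevDeriv ℓ u v → f =ᵐ[volume.restrict (Icc 0 ℓ)] u →
        g =ᵐ[volume.restrict (Icc 0 ℓ)] v → ‖f‖ ≤ R → ‖g‖ ≤ R → f ∈ K := by
  let M : ℝ := √ℓ / ℓ * R + √ℓ * R
  -- The bound `M` comes from `norm_le`, the modulus of continuity from `norm_sub_le`; together they
  -- give the hypotheses of Arzelà–Ascoli.
  let A : Set (BoundedContinuousFunction (Icc 0 ℓ) ℂ) :=
    {φ | (∀ x, φ x ∈ Metric.closedBall (0 : ℂ) M) ∧
      ∀ x y, dist (φ x) (φ y) ≤ √(dist x y) * R}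
  have hA : IsCompact (closure A) := by
    refine BoundedContinuousFunction.arzela_ascoli (Metric.closedBall 0 M)
      (isCompact_closedBall _ _) A (fun φ x hφ => hφ.1 x) ?_
    refine Metric.equicontinuous_of_continuity_modulus (fun d => √d * R) ?_ _
      fun x y φ => φ.2.2 x y
    have : Continuous fun d : ℝ => √d * R := by fun_prop
    simpa using this.tendsto 0
  refine ⟨continuousToL2 ℓ hℓ.le '' closure A, hA.image (continuous_continuousToL2 ℓ hℓ.le), ?_⟩
  intro u v f g h hf hg hfR hgR
  let φ : BoundedContinuousFunction (Icc 0 ℓ) ℂ :=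
    BoundedContinuousFunction.mkOfCompact ⟨(Icc 0 ℓ).domRestrict u, h.continuousOn'.domRestrict⟩
  refine ⟨φ, subset_closure ⟨fun x => ?_, fun x y => ?_⟩, ?_⟩
  · rw [mem_closedBall_zero_iff]
    refine (h.norm_le hℓ hf hg x.2).trans ?_
    simp only [M]
    gcongr
  · rw [dist_eq_norm, Subtype.dist_eq, Real.dist_eq]
    refine (h.norm_sub_le hg x.2 y.2).trans ?_
    gcongr
  · refine Lp.ext ((MemLp.coeFn_toLp _).trans ?_)
    filter_upwards [hf, ae_restrict_mem measurableSet_Icc] with x hx hxI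
    rw [hx, IccExtend_of_mem _ _ hxI]
    rfl

end HasSobolevDeriv

/-! ### Minimizers of the Rayleigh quotient in a Hilbert space -/

section Minimizer

open Filter Topology

variable {H : Type*} [NormedAddCommGroup H] [InnerProductSpace ℂ H]

/-- If the graph `X` of a closed operator has relatively compact first projections of bounded
sets, then the Rayleigh quotient `‖p.2‖ ^ 2 / ‖p.1‖ ^ 2` attains its minimum on `X`. -/
theorem exists_rayleigh_minimizer [CompleteSpace H] (X : Submodule ℂ (H × H))
    (hX : IsClosed (X : Set (H × H)))
    (hK : ∀ R : ℝ, ∃ K : Set H, IsCompact K ∧ ∀ p ∈ X, ‖p.1‖ ≤ R → ‖p.2‖ ≤ R → p.1 ∈ K)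
    (hne : ∃ p ∈ X, p.1 ≠ 0) :
    ∃ p ∈ X, p.1 ≠ 0 ∧ ∃ μ : ℝ, ‖p.2‖ ^ 2 = μ * ‖p.1‖ ^ 2 ∧
      ∀ q ∈ X, μ * ‖q.1‖ ^ 2 ≤ ‖q.2‖ ^ 2 := by
  let S : Set ℝ := {r | ∃ p ∈ X, ‖p.1‖ = 1 ∧ ‖p.2‖ ^ 2 = r}
  have hscale : ∀ q ∈ X, q.1 ≠ 0 → ‖q.2‖ ^ 2 / ‖q.1‖ ^ 2 ∈ S := fun q hq hq0 => by
    refine ⟨((‖q.1‖⁻¹ : ℝ) : ℂ) • q, X.smul_mem _ hq, ?_, ?_⟩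
    · simp [norm_smul, hq0]
    · simp only [Prod.smul_snd, norm_smul]
      simp
      ring
  have hS : S.Nonempty := by
    obtain ⟨p, hp, hp0⟩ := hne
    exact ⟨_, hscale p hp hp0⟩
  have hSb : BddBelow S := ⟨0, by rintro r ⟨p, -, -, rfl⟩; positivity⟩
  let μ := sInf S
  have hmin : ∀ q ∈ X, μ * ‖q.1‖ ^ 2 ≤ ‖q.2‖ ^ 2 := fun q hq => by
    by_cases hq0 : q.1 = 0
    · simp [hq0]
    · rw [← le_div_iff₀ (by positivity)]
      exact csInf_le hSb (hscale q hq hq0)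
  obtain ⟨r, -, hr, hrS⟩ := exists_seq_tendsto_sInf hS hSb
  choose p hpX hp1 hp2 using hrS
  obtain ⟨B, hB⟩ := hr.bddAbove_range
  -- From `t ^ 2 ≤ B` and `2 * t ≤ 1 + t ^ 2` one gets `t ≤ 1 + B`; the maximum with `1` makes the
  -- same radius cover `‖(p n).1‖ = 1`.
  have hB' : ∀ n, ‖(p n).2‖ ≤ max 1 (1 + B) := fun n => by
    have h1 : ‖(p n).2‖ ^ 2 ≤ B := (hp2 n).le.trans (hB ⟨n, rfl⟩)
    refine le_trans ?_ (le_max_right _ _)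
    nlinarith [sq_nonneg (‖(p n).2‖ - 1), norm_nonneg (p n).2]
  obtain ⟨K, hKc, hKm⟩ := hK (max 1 (1 + B))
  obtain ⟨a, -, φ, hφ, ha⟩ := hKc.tendsto_subseq (x := fun n => (p n).1) fun n =>
    hKm _ (hpX n) ((hp1 n).le.trans (le_max_left _ _)) (hB' n)
  have hr' : Tendsto (r ∘ φ) atTop (𝓝 μ) := hr.comp hφ.tendsto_atTop
  -- Parallelogram law in both components, with the energy of the sum bounded below by the infimum
  -- `μ`. Convergence of the first components therefore forces the second components to be Cauchy.
  have hbound : ∀ n m, ‖(p n).2 - (p m).2‖ ^ 2 ≤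
      2 * (r n - μ) + 2 * (r m - μ) + μ * ‖(p n).1 - (p m).1‖ ^ 2 := fun n m => by
    have e1 := parallelogram_law_with_norm ℂ (p n).1 (p m).1
    have e2 := parallelogram_law_with_norm ℂ (p n).2 (p m).2
    have e3 := hmin _ (X.add_mem (hpX n) (hpX m))
    simp only [Prod.fst_add, Prod.snd_add] at e3
    rw [hp1, hp1] at e1
    have e4 : ‖(p n).1 + (p m).1‖ ^ 2 = 4 - ‖(p n).1 - (p m).1‖ ^ 2 := by linarith
    rw [e4] at e3
    have := hp2 n
    have := hp2 m
    nlinarith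
  have hcau : CauchySeq fun n => (p (φ n)).2 := by
    rw [cauchySeq_iff_tendsto_dist_atTop_0]
    have h1 := cauchySeq_iff_tendsto_dist_atTop_0.1 ha.cauchySeq
    have h2 : Tendsto (fun n : ℕ × ℕ => 2 * (r (φ n.1) - μ) + 2 * (r (φ n.2) - μ) +
        μ * dist (p (φ n.1)).1 (p (φ n.2)).1 ^ 2) atTop (𝓝 0) := by
      have f1 : Tendsto (fun n : ℕ × ℕ => r (φ n.1)) atTop (𝓝 μ) := by
        rw [← prod_atTop_atTop_eq]
        exact hr'.comp tendsto_fst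
      have f2 : Tendsto (fun n : ℕ × ℕ => r (φ n.2)) atTop (𝓝 μ) := by
        rw [← prod_atTop_atTop_eq]
        exact hr'.comp tendsto_snd
      have := (((f1.sub_const μ).const_mul 2).add ((f2.sub_const μ).const_mul 2)).add
        ((h1.pow 2).const_mul μ)
      simpa using this
    have h3 := (Real.continuous_sqrt.tendsto 0).comp h2
    rw [Real.sqrt_zero] at h3
    refine squeeze_zero (fun _ => dist_nonneg) (fun n => ?_) h3
    refine Real.le_sqrt_of_sq_le ?_
    simpa [dist_eq_norm] using hbound (φ n.1) (φ n.2)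
  obtain ⟨b, hb⟩ := cauchySeq_tendsto_of_complete hcau
  have hab : (a, b) ∈ X := hX.mem_of_tendsto (ha.prodMk_nhds hb)
    (Eventually.of_forall fun n => hpX (φ n))
  have ha1 : ‖a‖ = 1 := tendsto_nhds_unique ha.norm (by simp [hp1])
  have hb1 : ‖b‖ ^ 2 = μ := tendsto_nhds_unique (hb.norm.pow 2)
    (hr'.congr fun n => (hp2 (φ n)).symm)
  refine ⟨(a, b), hab, ?_, μ, ?_, hmin⟩
  · rintro rfl
    simp at ha1
  · simp [ha1, hb1]

/-- The Euler–Lagrange equation: for real `t` the expression `‖p.2 + t q.2‖ ^ 2 - μ ‖p.1 + t q.1‖ ^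
2` is a nonnegative quadratic polynomial with vanishing constant term, so its discriminant forces
the linear coefficient to vanish. Replacing `q` by `i q` turns the equality of real parts into one
of complex numbers. -/
theorem inner_eq_of_rayleigh_minimizer (X : Submodule ℂ (H × H)) {p : H × H} (hp : p ∈ X) {μ : ℝ}
    (hpμ : ‖p.2‖ ^ 2 = μ * ‖p.1‖ ^ 2) (hmin : ∀ q ∈ X, μ * ‖q.1‖ ^ 2 ≤ ‖q.2‖ ^ 2)
    {q : H × H} (hq : q ∈ X) : inner ℂ q.2 p.2 = μ * inner ℂ q.1 p.1 := by
  have hre : ∀ q ∈ X, (inner ℂ q.2 p.2).re = μ * (inner ℂ q.1 p.1).re := fun q hq => by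
    have h1 : ∀ t : ℝ, 0 ≤ (‖q.2‖ ^ 2 - μ * ‖q.1‖ ^ 2) * (t * t) +
        (2 * ((inner ℂ q.2 p.2).re - μ * (inner ℂ q.1 p.1).re)) * t + 0 := fun t => by
      have h2 := hmin _ (X.add_mem (X.smul_mem (t : ℂ) hq) hp)
      simp only [Prod.fst_add, Prod.snd_add, Prod.smul_fst, Prod.smul_snd] at h2
      rw [norm_add_sq (𝕜 := ℂ), norm_add_sq (𝕜 := ℂ), inner_smul_left, inner_smul_left,
        norm_smul, norm_smul] at h2
      simp only [Complex.conj_ofReal, RCLike.re_to_complex, Complex.re_ofReal_mul, mul_pow,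
        Complex.norm_real, Real.norm_eq_abs, sq_abs] at h2
      nlinarith
    have h3 := discrim_le_zero h1
    simp only [discrim, mul_zero, sub_zero] at h3
    have h4 := pow_eq_zero_iff (two_ne_zero) |>.1 (le_antisymm h3 (sq_nonneg _))
    linarith
  have h1 := hre q hq
  have h2 := hre _ (X.smul_mem Complex.I hq)
  simp only [Prod.smul_fst, Prod.smul_snd, inner_smul_left] at h2
  apply Complex.ext
  · simpa using h1
  · simpa using h2

end Minimizer

/-! ### The Sobolev space of a metric graph -/

namespace MetricGraph

open Filter Topology

variable {V E : Type*} (Γ : MetricGraph V E)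

/-- `u` belongs to the Sobolev space `W^1_2` of the metric graph, with derivative `v`: it does so
on every edge and is continuous at the vertices. -/
structure IsSobolev (u v : E → ℝ → ℂ) : Prop where
  deriv : ∀ e, HasSobolevDeriv (Γ.len e) (u e) (v e)
  continuous : ∃ c : V → ℂ, ∀ e, u e 0 = c (Γ.src e) ∧ u e (Γ.len e) = c (Γ.tgt e)

variable {Γ}

namespace IsSobolev

variable {u v u₁ v₁ : E → ℝ → ℂ}

theorem add (h : Γ.IsSobolev u v) (k : Γ.IsSobolev u₁ v₁) : Γ.IsSobolev (u + u₁) (v + v₁) := by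
  obtain ⟨c, hc⟩ := h.continuous
  obtain ⟨d, hd⟩ := k.continuous
  exact ⟨fun e => (h.deriv e).add (k.deriv e), c + d, fun e => by
    simp [(hc e).1, (hc e).2, (hd e).1, (hd e).2]⟩

theorem smul (a : ℂ) (h : Γ.IsSobolev u v) : Γ.IsSobolev (a • u) (a • v) := by
  obtain ⟨c, hc⟩ := h.continuous
  exact ⟨fun e => (h.deriv e).smul a, a • c, fun e => by simp [(hc e).1, (hc e).2]⟩

theorem sub (h : Γ.IsSobolev u v) (k : Γ.IsSobolev u₁ v₁) : Γ.IsSobolev (u - u₁) (v - v₁) := by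
  simpa [sub_eq_add_neg] using h.add (k.smul (-1))

theorem const (c : ℂ) : Γ.IsSobolev (fun _ _ => c) 0 :=
  ⟨fun _ => .const _ c, fun _ => c, fun _ => ⟨rfl, rfl⟩⟩

end IsSobolev

variable [Fintype E]

variable (Γ) in
/-- The class of the square integrable function `u` is `f`. -/
def Represents (f : Γ.L2) (u : E → ℝ → ℂ) : Prop :=
  ∀ e, f e =ᵐ[volume.restrict (Icc 0 (Γ.len e))] u e

theorem Represents.add {f g : Γ.L2} {u w : E → ℝ → ℂ} (hf : Γ.Represents f u)
    (hg : Γ.Represents g w) : Γ.Represents (f + g) (u + w) := fun e => by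
  filter_upwards [Lp.coeFn_add (f e) (g e), hf e, hg e] with x a1 a2 a3
  simpa [a2, a3] using a1

theorem Represents.smul {f : Γ.L2} {u : E → ℝ → ℂ} (c : ℂ) (hf : Γ.Represents f u) :
    Γ.Represents (c • f) (c • u) := fun e => by
  filter_upwards [Lp.coeFn_smul c (f e), hf e] with x a1 a2
  simpa [a2] using a1

theorem Represents.sub {f g : Γ.L2} {u w : E → ℝ → ℂ} (hf : Γ.Represents f u)
    (hg : Γ.Represents g w) : Γ.Represents (f - g) (u - w) := by
  simpa [sub_eq_add_neg] using hf.add (hg.smul (-1))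

theorem Represents.zero : Γ.Represents 0 0 := fun e => by
  simpa using Lp.coeFn_zero ℂ 2 (volume.restrict (Icc 0 (Γ.len e)))

theorem exists_represents {u : E → ℝ → ℂ}
    (h : ∀ e, MemLp (u e) 2 (volume.restrict (Icc 0 (Γ.len e)))) :
    ∃ f : Γ.L2, Γ.Represents f u :=
  ⟨WithLp.toLp 2 fun e => (h e).toLp (u e), fun e => (h e).coeFn_toLp⟩

theorem Represents.inner_eq {f g : Γ.L2} {u w : E → ℝ → ℂ} (hf : Γ.Represents f u)
    (hg : Γ.Represents g w) :
    inner ℂ f g = ∑ e, ∫ x in 0..Γ.len e, starRingEnd ℂ (u e x) * w e x := by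
  rw [PiLp.inner_apply]
  refine Finset.sum_congr rfl fun e _ => ?_
  rw [L2.inner_def, ← HasSobolevDeriv.integral_Icc_eq (Γ.len_pos e).le]
  refine integral_congr_ae ?_
  filter_upwards [hf e, hg e] with x h1 h2
  rw [h1, h2, RCLike.inner_apply, mul_comm]

theorem Represents.norm_sq_eq {f : Γ.L2} {u : E → ℝ → ℂ} (hf : Γ.Represents f u) :
    ‖f‖ ^ 2 = ∑ e, ∫ x in 0..Γ.len e, ‖u e x‖ ^ 2 := by
  have h1 := inner_self_eq_norm_sq_to_K (𝕜 := ℂ) f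
  rw [hf.inner_eq hf] at h1
  have h2 : ∀ e x, starRingEnd ℂ (u e x) * u e x = ((‖u e x‖ ^ 2 : ℝ) : ℂ) := fun e x => by
    rw [Complex.conj_mul']
    simp
  simp only [h2, intervalIntegral.integral_ofReal] at h1
  refine Complex.ofReal_injective ?_
  rw [Complex.ofReal_sum, h1]
  simp

variable (Γ)

/-- The graph `{(f, f')}` of the derivative on the Sobolev space `W^1_2` of a metric graph. -/
def sobolevGraph : Submodule ℂ (Γ.L2 × Γ.L2) where
  carrier := {p | ∃ u v, Γ.IsSobolev u v ∧ Γ.Represents p.1 u ∧ Γ.Represents p.2 v}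
  zero_mem' := ⟨0, 0, .const 0, .zero, .zero⟩
  add_mem' := by
    rintro p q ⟨u, v, h, hu, hv⟩ ⟨u₁, v₁, k, ku, kv⟩
    exact ⟨_, _, h.add k, hu.add ku, hv.add kv⟩
  smul_mem' := by
    rintro c p ⟨u, v, h, hu, hv⟩
    exact ⟨_, _, h.smul c, hu.smul c, hv.smul c⟩

variable {Γ}

theorem norm_apply_le (f : Γ.L2) (e : E) : ‖f e‖ ≤ ‖f‖ := PiLp.norm_apply_le f e

/-- Bounded sets of the Sobolev space are relatively compact in `L₂`. -/
theorem sobolevGraph_relativelyCompact (R : ℝ) : ∃ K : Set Γ.L2, IsCompact K ∧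
    ∀ p ∈ Γ.sobolevGraph, ‖p.1‖ ≤ R → ‖p.2‖ ≤ R → p.1 ∈ K := by
  choose K hK hKm using fun e => HasSobolevDeriv.exists_isCompact (Γ.len_pos e) R
  refine ⟨WithLp.toLp 2 '' Set.pi univ K,
    (isCompact_univ_pi hK).image (PiLp.continuous_toLp 2 _), ?_⟩
  rintro p ⟨u, v, h, hu, hv⟩ h1 h2
  refine ⟨WithLp.ofLp p.1, fun e _ => ?_, rfl⟩
  exact hKm e (u e) (v e) (p.1 e) (p.2 e) (h.deriv e) (hu e) (hv e)
    ((norm_apply_le p.1 e).trans h1) ((norm_apply_le p.2 e).trans h2)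

/-- By `HasSobolevDeriv.norm_le`, convergence in the graph norm forces convergence of the continuous
representatives at every point. Hence the primitive formula and the matching of values at the
vertices pass to the limit. -/
theorem isClosed_sobolevGraph : IsClosed (Γ.sobolevGraph : Set (Γ.L2 × Γ.L2)) := by
  refine IsSeqClosed.isClosed fun p q hp hq => ?_
  choose u v h hu hv using hp
  have hC : ∀ e, ∀ x ∈ Icc 0 (Γ.len e), ∀ n m, dist (u n e x) (u m e x) ≤
      (√(Γ.len e) / Γ.len e + √(Γ.len e)) * dist (p n) (p m) := fun e x hx n m => by
    have h1 := (((h n).sub (h m)).deriv e).norm_le (Γ.len_pos e) (((hu n).sub (hu m)) e)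
      (((hv n).sub (hv m)) e) hx
    rw [dist_eq_norm, dist_eq_norm, add_mul]
    refine h1.trans ?_
    have := Γ.len_pos e
    gcongr
    · exact (norm_apply_le _ e).trans (norm_fst_le (p n - p m))
    · exact (norm_apply_le _ e).trans (norm_snd_le (p n - p m))
  have hlim : ∀ e, ∀ x ∈ Icc 0 (Γ.len e), ∃ a, Tendsto (fun n => u n e x) atTop (𝓝 a) := by
    intro e x hx
    refine cauchySeq_tendsto_of_complete ?_
    rw [cauchySeq_iff_tendsto_dist_atTop_0]
    have h1 := (cauchySeq_iff_tendsto_dist_atTop_0.1 hq.cauchySeq).const_mul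
      (√(Γ.len e) / Γ.len e + √(Γ.len e))
    rw [mul_zero] at h1
    exact squeeze_zero (fun _ => dist_nonneg) (fun n => hC e x hx n.1 n.2) h1
  let U : E → ℝ → ℂ := fun e x => limUnder atTop fun n => u n e x
  have hU : ∀ e, ∀ x ∈ Icc 0 (Γ.len e), Tendsto (fun n => u n e x) atTop (𝓝 (U e x)) :=
    fun e x hx => tendsto_nhds_limUnder (hlim e x hx)
  have hq1 : ∀ e, Tendsto (fun n => (p n).1 e) atTop (𝓝 (q.1 e)) := fun e =>
    ((PiLp.continuous_apply 2 _ e).tendsto _).comp ((continuous_fst.tendsto _).comp hq)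
  have hq2 : ∀ e, Tendsto (fun n => (p n).2 e) atTop (𝓝 (q.2 e)) := fun e =>
    ((PiLp.continuous_apply 2 _ e).tendsto _).comp ((continuous_snd.tendsto _).comp hq)
  refine ⟨U, fun e => q.2 e, ⟨fun e => ⟨Lp.memLp _, fun x hx => ?_⟩, ?_⟩, fun e => ?_,
    fun e => Filter.EventuallyEq.rfl⟩
  · have h0 : (0 : ℝ) ∈ Icc 0 (Γ.len e) := left_mem_Icc.2 (Γ.len_pos e).le
    have hI : Tendsto (fun n => ∫ t in 0..x, v n e t) atTop (𝓝 (∫ t in 0..x, q.2 e t)) := by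
      -- The integral over `Ioc 0 x` is an inner product with a fixed vector, hence continuous in
      -- `f`.
      have e1 : ∀ f : Lp ℂ 2 (volume.restrict (Icc 0 (Γ.len e))),
          ∫ t in 0..x, f t = inner ℂ (indicatorConstLp 2 (measurableSet_Ioc (a := (0 : ℝ)) (b := x))
            (measure_ne_top (volume.restrict (Icc 0 (Γ.len e))) _) 1) f := fun f => by
        rw [L2.inner_indicatorConstLp_one, intervalIntegral.integral_of_le hx.1,
          Measure.restrict_restrict measurableSet_Ioc, inter_eq_self_of_subset_left]
        exact fun t ht => ⟨ht.1.le, ht.2.trans hx.2⟩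
      have e2 : ∀ n, ∫ t in 0..x, v n e t = ∫ t in 0..x, (p n).2 e t := fun n =>
        (HasSobolevDeriv.intervalIntegral_congr_ae_restrict (hv n e) h0 hx).symm
      simp only [e2, e1]
      exact tendsto_const_nhds.inner (hq2 e)
    refine tendsto_nhds_unique (hU e x hx) ?_
    refine ((hU e 0 h0).add hI).congr fun n => ?_
    exact (((h n).deriv e).2 x hx).symm
  · choose c hc using fun n => (h n).continuous
    -- At an end of an edge both sides are limits of the same sequence. At a vertex without edges
    -- the limit may not exist, but then its value is never tested.
    refine ⟨fun a => limUnder atTop fun n => c n a, fun e => ⟨?_, ?_⟩⟩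
    · simp only [U, (hc _ e).1]
    · simp only [U, (hc _ e).2]
  · obtain ⟨φ, hφ, h1⟩ := (tendstoInMeasure_of_tendsto_Lp (hq1 e)).exists_seq_tendsto_ae
    have h2 : ∀ᵐ x ∂(volume.restrict (Icc 0 (Γ.len e))), ∀ n, (p n).1 e x = u n e x :=
      ae_all_iff.2 fun n => hu n e
    filter_upwards [h1, h2, ae_restrict_mem measurableSet_Icc] with x a1 a2 a3
    refine tendsto_nhds_unique a1 ?_
    simp only [a2]
    exact (hU e x a3).comp hφ.tendsto_atTop

end MetricGraph

/-! ### Regularity on an interval: the lemma of du Bois-Reymond -/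

/-- The lemma of du Bois-Reymond: a square integrable function that is orthogonal to the
derivatives of all Sobolev functions vanishing at the end points is constant. -/
theorem HasSobolevDeriv.ae_eq_const_of_forall_integral_eq_zero {ℓ : ℝ} (hℓ : 0 < ℓ) {g : ℝ → ℂ}
    (hg : MemLp g 2 (volume.restrict (Icc 0 ℓ)))
    (h : ∀ φ ψ, HasSobolevDeriv ℓ φ ψ → φ 0 = 0 → φ ℓ = 0 →
      ∫ x in 0..ℓ, starRingEnd ℂ (ψ x) * g x = 0) :
    ∃ γ : ℂ, g =ᵐ[volume.restrict (Icc 0 ℓ)] fun _ => γ := by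
  -- With `γ` the mean value of `g`, the primitive of `g - γ` vanishes at both ends and is
  -- admissible. Testing with it gives `∫ ‖g - γ‖ ^ 2 = 0`.
  let γ : ℂ := (∫ x in 0..ℓ, g x) / ℓ
  have hγ : MemLp (fun x => g x - γ) 2 (volume.restrict (Icc 0 ℓ)) := hg.sub (memLp_const γ)
  have hφ : HasSobolevDeriv ℓ (fun x => ∫ t in 0..x, (g t - γ)) fun x => g x - γ :=
    ⟨hγ, fun x _ => by simp⟩
  have hgi : IntervalIntegrable g volume 0 ℓ := by
    rw [intervalIntegrable_iff_integrableOn_Icc_of_le hℓ.le]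
    exact hg.integrable (by norm_num)
  have h0 : ∫ t in 0..ℓ, (g t - γ) = 0 := by
    rw [intervalIntegral.integral_sub hgi (by simp), intervalIntegral.integral_const]
    have : (ℓ : ℂ) ≠ 0 := Complex.ofReal_ne_zero.2 hℓ.ne'
    simp [γ, mul_div_cancel₀ _ this]
  have h1 := h _ _ hφ (by simp) h0
  have hci : IntervalIntegrable (fun x => starRingEnd ℂ (g x - γ)) volume 0 ℓ :=
    hφ.conj.intervalIntegrable (right_mem_Icc.2 hℓ.le)
  have h2 : ∫ x in 0..ℓ, starRingEnd ℂ (g x - γ) * γ = 0 := by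
    rw [intervalIntegral.integral_mul_const]
    have := (Complex.conjCLE : ℂ →L[ℝ] ℂ).intervalIntegral_comp_comm
      (hφ.intervalIntegrable (right_mem_Icc.2 hℓ.le))
    simp only [ContinuousLinearEquiv.coe_coe, Complex.conjCLE_apply] at this
    rw [this, h0]
    simp
  have hi1 : IntervalIntegrable (fun x => starRingEnd ℂ (g x - γ) * g x) volume 0 ℓ := by
    rw [intervalIntegrable_iff_integrableOn_Icc_of_le hℓ.le]
    exact (hφ.conj.1.integrable_mul hg)
  have h3 : ∫ x in 0..ℓ, ((‖g x - γ‖ ^ 2 : ℝ) : ℂ) = 0 := by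
    have : ∀ x, ((‖g x - γ‖ ^ 2 : ℝ) : ℂ) =
        starRingEnd ℂ (g x - γ) * g x - starRingEnd ℂ (g x - γ) * γ := fun x => by
      rw [← mul_sub, Complex.conj_mul']
      simp
    simp only [this]
    rw [intervalIntegral.integral_sub hi1 (hci.mul_const γ), h1, h2, sub_zero]
  rw [intervalIntegral.integral_ofReal, Complex.ofReal_eq_zero,
    ← HasSobolevDeriv.integral_Icc_eq hℓ.le] at h3
  rw [integral_eq_zero_iff_of_nonneg (fun x => by positivity)
    (hγ.integrable_norm_pow (by norm_num))] at h3
  refine ⟨γ, ?_⟩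
  filter_upwards [h3] with x hx
  simpa [sub_eq_zero] using hx

/-! ### The minimum of the Rayleigh quotient over functions with mean value zero -/

namespace MetricGraph

open Filter Topology

variable {V E : Type*} [Fintype E] {Γ : MetricGraph V E}

/-- The constant function `1`. -/
def one (Γ : MetricGraph V E) : Γ.L2 := WithLp.toLp 2 fun _ => (memLp_const (1 : ℂ)).toLp _

theorem represents_one : Γ.Represents Γ.one fun _ _ => 1 :=
  fun _ => (memLp_const (1 : ℂ)).coeFn_toLp

theorem Represents.inner_one {f : Γ.L2} {u : E → ℝ → ℂ} (hf : Γ.Represents f u) :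
    inner ℂ Γ.one f = ∑ e, ∫ x in 0..Γ.len e, u e x := by
  rw [represents_one.inner_eq hf]
  simp

theorem norm_one_sq : ‖Γ.one‖ ^ 2 = Γ.totalLength := by
  rw [represents_one.norm_sq_eq]
  simp [totalLength]

theorem one_mem_sobolevGraph : (Γ.one, 0) ∈ Γ.sobolevGraph :=
  ⟨_, _, .const 1, represents_one, .zero⟩

theorem totalLength_pos [Nonempty E] : 0 < Γ.totalLength :=
  Finset.sum_pos (fun e _ => Γ.len_pos e) Finset.univ_nonempty

/-- `μ` is the minimum of the Rayleigh quotient over the Sobolev functions with mean value zero,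
and it is attained at `p`. -/
structure IsGapMinimizer (Γ : MetricGraph V E) (μ : ℝ) (p : Γ.L2 × Γ.L2) : Prop where
  mem : p ∈ Γ.sobolevGraph
  ne_zero : p.1 ≠ 0
  inner_one : inner ℂ Γ.one p.1 = 0
  rayleigh : ‖p.2‖ ^ 2 = μ * ‖p.1‖ ^ 2
  le : ∀ q ∈ Γ.sobolevGraph, inner ℂ Γ.one q.1 = 0 → μ * ‖q.1‖ ^ 2 ≤ ‖q.2‖ ^ 2

/-- The Sobolev functions with mean value zero. -/
def meanZeroGraph (Γ : MetricGraph V E) : Submodule ℂ (Γ.L2 × Γ.L2) :=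
  Γ.sobolevGraph ⊓
    LinearMap.ker ((innerSL ℂ Γ.one).toLinearMap ∘ₗ LinearMap.fst ℂ Γ.L2 Γ.L2)

theorem exists_mem_meanZeroGraph [Nonempty E] : ∃ p ∈ Γ.meanZeroGraph, p.1 ≠ 0 := by
  classical
  obtain ⟨e₀⟩ := ‹Nonempty E›
  let ℓ := Γ.len e₀
  have hℓ : 0 < ℓ := Γ.len_pos e₀
  -- A cubic on a single edge: it vanishes at both ends, so it extends by zero to the graph, and it
  -- is odd about the midpoint, so its mean value is zero. It is positive at `ℓ / 4`.
  let r : ℝ → ℂ := fun x => ((x * (ℓ - x) * (ℓ - 2 * x) : ℝ) : ℂ)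
  let r' : ℝ → ℂ := fun x => (((1 * (ℓ - x) + x * (-1)) * (ℓ - 2 * x) +
    x * (ℓ - x) * (-(2 * 1)) : ℝ) : ℂ)
  have hr : HasSobolevDeriv ℓ r r' := by
    refine .of_hasDerivAt (fun x => ?_) (by fun_prop)
    exact HasDerivAt.ofReal_comp ((((hasDerivAt_id x).mul ((hasDerivAt_id x).const_sub ℓ))).mul
      (((hasDerivAt_id x).const_mul 2).const_sub ℓ))
  let u : E → ℝ → ℂ := Pi.single e₀ r
  let v : E → ℝ → ℂ := Pi.single e₀ r'
  have hu : Γ.IsSobolev u v := by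
    refine ⟨fun e => ?_, 0, fun e => ?_⟩
    · by_cases he : e = e₀
      · subst he; simpa [u, v] using hr
      · simpa [u, v, he] using HasSobolevDeriv.zero _
    · by_cases he : e = e₀
      · subst he; simp [u, r, ℓ]
      · simp [u, he]
  obtain ⟨f, hf⟩ := exists_represents fun e => (hu.deriv e).memLp
  obtain ⟨g, hg⟩ := exists_represents fun e => (hu.deriv e).1
  refine ⟨(f, g), ⟨⟨u, v, hu, hf, hg⟩, ?_⟩, ?_⟩
  · change inner ℂ Γ.one f = 0
    rw [hf.inner_one, Finset.sum_eq_single e₀ (fun e _ he => by simp [u, he]) (by simp)]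
    have h1 := intervalIntegral.integral_comp_sub_left (a := 0) (b := ℓ) r ℓ
    have h2 : ∀ x, r (ℓ - x) = -r x := fun x => by
      simp only [r, ← Complex.ofReal_neg]
      congr 1
      ring
    simp only [h2, intervalIntegral.integral_neg, sub_self, sub_zero] at h1
    have h3 : ∫ x in 0..ℓ, r x = 0 := self_eq_neg.1 h1.symm
    simpa [u] using h3
  · rintro rfl
    have h1 : u e₀ =ᵐ[volume.restrict (Icc 0 ℓ)] 0 := by
      have := Represents.zero (Γ := Γ) e₀
      exact (hf e₀).symm.trans this
    have h2 := Measure.eqOn_Icc_of_ae_eq volume hℓ.ne h1 (hu.deriv e₀).continuousOn'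
      continuousOn_const (x := ℓ / 4) ⟨by linarith, by linarith⟩
    simp only [u, r, Pi.single_eq_same, Pi.zero_apply, Complex.ofReal_eq_zero] at h2
    have h3 : 0 < ℓ / 4 * (ℓ - ℓ / 4) * (ℓ - 2 * (ℓ / 4)) := by
      have : 0 < ℓ - ℓ / 4 := by linarith
      have : 0 < ℓ - 2 * (ℓ / 4) := by linarith
      positivity
    exact h3.ne' h2

theorem exists_isGapMinimizer [Nonempty E] (Γ : MetricGraph V E) :
    ∃ μ p, Γ.IsGapMinimizer μ p := by
  have hc : IsClosed (Γ.meanZeroGraph : Set (Γ.L2 × Γ.L2)) := by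
    refine isClosed_sobolevGraph.inter ?_
    have : Continuous fun p : Γ.L2 × Γ.L2 => inner ℂ Γ.one p.1 :=
      continuous_const.inner continuous_fst
    exact isClosed_singleton.preimage this
  obtain ⟨p, hp, hp0, μ, h1, h2⟩ := exists_rayleigh_minimizer Γ.meanZeroGraph hc
    (fun R => by
      obtain ⟨K, hK, h⟩ := Γ.sobolevGraph_relativelyCompact R
      exact ⟨K, hK, fun p hp => h p hp.1⟩)
    exists_mem_meanZeroGraph
  exact ⟨μ, p, hp.1, hp0, hp.2, h1, fun q hq hq1 => h2 q ⟨hq, hq1⟩⟩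

theorem inner_one_one : inner ℂ Γ.one Γ.one = (Γ.totalLength : ℂ) := by
  rw [inner_self_eq_norm_sq_to_K, ← norm_one_sq]
  simp

/-- The minimum of the Rayleigh quotient is an optimal constant in the Poincaré inequality. -/
theorem IsGapMinimizer.le_of_mem [Nonempty E] {μ : ℝ} {p : Γ.L2 × Γ.L2}
    (h : Γ.IsGapMinimizer μ p) {q : Γ.L2 × Γ.L2} (hq : q ∈ Γ.sobolevGraph) :
    μ * (‖q.1‖ ^ 2 - ‖inner ℂ Γ.one q.1‖ ^ 2 / Γ.totalLength) ≤ ‖q.2‖ ^ 2 := by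
  have hL : (Γ.totalLength : ℂ) ≠ 0 := Complex.ofReal_ne_zero.2 totalLength_pos.ne'
  let m : ℂ := inner ℂ Γ.one q.1 / Γ.totalLength
  have h1 : inner ℂ Γ.one (q.1 - m • Γ.one) = 0 := by
    rw [inner_sub_right, inner_smul_right, inner_one_one]
    simp [m, hL]
  have h2 := h.le (q - m • (Γ.one, 0))
    (Γ.sobolevGraph.sub_mem hq (Γ.sobolevGraph.smul_mem m one_mem_sobolevGraph)) (by simpa using h1)
  -- Pythagoras for the decomposition of `q.1` into its mean-zero part and the constant `m`.
  have h3 : ‖q.1‖ ^ 2 = ‖q.1 - m • Γ.one‖ ^ 2 + ‖inner ℂ Γ.one q.1‖ ^ 2 / Γ.totalLength := by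
    have e : q.1 = (q.1 - m • Γ.one) + m • Γ.one := by simp
    have h4 : inner ℂ (q.1 - m • Γ.one) (m • Γ.one) = 0 := by
      rw [inner_smul_right, ← inner_conj_symm, h1]
      simp
    have h5 := norm_add_sq_eq_norm_sq_add_norm_sq_of_inner_eq_zero _ _ h4
    rw [← e] at h5
    rw [pow_two, h5, norm_smul, mul_mul_mul_comm, ← pow_two ‖Γ.one‖, norm_one_sq, ← pow_two]
    simp only [m, norm_div, Complex.norm_real, Real.norm_eq_abs, abs_of_pos Γ.totalLength_pos]
    have := Γ.totalLength_pos.ne'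
    field_simp
  rw [h3]
  simpa using h2

theorem IsGapMinimizer.nonneg {μ : ℝ} {p : Γ.L2 × Γ.L2} (h : Γ.IsGapMinimizer μ p) : 0 ≤ μ := by
  have h1 := h.rayleigh
  have h2 : 0 < ‖p.1‖ ^ 2 := by have := h.ne_zero; positivity
  by_contra! h3
  nlinarith [sq_nonneg ‖p.2‖]

/-- The Euler–Lagrange equation is known for test functions with mean value zero. It extends to all
test functions because subtracting a constant changes neither side: the derivative is unaffected,
and `p.1` is orthogonal to constants. -/
theorem IsGapMinimizer.inner_eq [Nonempty E] {μ : ℝ} {p : Γ.L2 × Γ.L2}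
    (h : Γ.IsGapMinimizer μ p) {q : Γ.L2 × Γ.L2} (hq : q ∈ Γ.sobolevGraph) :
    inner ℂ q.2 p.2 = μ * inner ℂ q.1 p.1 := by
  have hL : (Γ.totalLength : ℂ) ≠ 0 := Complex.ofReal_ne_zero.2 totalLength_pos.ne'
  let m : ℂ := inner ℂ Γ.one q.1 / Γ.totalLength
  have h1 : inner ℂ Γ.one (q.1 - m • Γ.one) = 0 := by
    rw [inner_sub_right, inner_smul_right, inner_one_one]
    simp [m, hL]
  have h2 : q - m • (Γ.one, 0) ∈ Γ.meanZeroGraph :=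
    ⟨Γ.sobolevGraph.sub_mem hq (Γ.sobolevGraph.smul_mem m one_mem_sobolevGraph), by
      change inner ℂ Γ.one (q - m • (Γ.one, 0)).1 = 0
      simpa using h1⟩
  have h3 := inner_eq_of_rayleigh_minimizer Γ.meanZeroGraph ⟨h.mem, h.inner_one⟩ h.rayleigh
    (fun q hq => h.le q hq.1 hq.2) h2
  simpa [inner_sub_left, inner_smul_left, h.inner_one] using h3

end MetricGraph

/-! ### Green's identity and the variational characterization of the eigenvalue $\lambda_1$ -/

namespace MetricGraph

variable {V E : Type*} [Fintype E] {Γ : MetricGraph V E}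

/-- **Green's identity**: integration by parts against a function from the domain of the standard
Laplacian produces no boundary terms. -/
theorem IsStandard.sum_integral_eq [Finite V] {u u' u'' φ ψ : E → ℝ → ℂ}
    (h : Γ.IsStandard u u' u'') (k : Γ.IsSobolev φ ψ) :
    ∑ e, ∫ x in 0..Γ.len e, starRingEnd ℂ (ψ e x) * u' e x =
      -∑ e, ∫ x in 0..Γ.len e, starRingEnd ℂ (φ e x) * u'' e x := by
  classical
  have := Fintype.ofFinite V
  obtain ⟨c, hc⟩ := k.continuous
  rw [← sub_eq_zero, sub_neg_eq_add, ← Finset.sum_add_distrib]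
  -- The boundary terms of an edge are spread over all vertices, so that exchanging the two sums
  -- collects the Kirchhoff sum at each vertex.
  have h1 : ∀ e, (∫ x in 0..Γ.len e, starRingEnd ℂ (ψ e x) * u' e x) +
      ∫ x in 0..Γ.len e, starRingEnd ℂ (φ e x) * u'' e x =
      ∑ a, -(starRingEnd ℂ (c a) * ((if Γ.src e = a then u' e 0 else 0) -
        (if Γ.tgt e = a then u' e (Γ.len e) else 0))) := fun e => by
    have hl := (Γ.len_pos e).le
    have hi1 : IntervalIntegrable (fun x => starRingEnd ℂ (ψ e x) * u' e x) volume 0 (Γ.len e) := by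
      rw [intervalIntegrable_iff_integrableOn_Icc_of_le hl]
      exact (k.deriv e).conj.1.integrable_mul (h.deriv_snd e).memLp
    have hi2 : IntervalIntegrable (fun x => starRingEnd ℂ (φ e x) * u'' e x) volume 0
        (Γ.len e) := by
      rw [intervalIntegrable_iff_integrableOn_Icc_of_le hl]
      exact (k.deriv e).conj.memLp.integrable_mul (h.deriv_snd e).1
    rw [← intervalIntegral.integral_add hi1 hi2,
      (k.deriv e).conj.integral_mul_add_mul hl (h.deriv_snd e), (hc e).1, (hc e).2]
    simp only [mul_sub, neg_sub, Finset.sum_sub_distrib, mul_ite, mul_zero, Finset.sum_ite_eq,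
      Finset.mem_univ, if_true]
  simp only [h1]
  rw [Finset.sum_comm]
  refine Finset.sum_eq_zero fun a _ => ?_
  rw [Finset.sum_neg_distrib, ← Finset.mul_sum, h.kirchhoff a, mul_zero, neg_zero]

/-- A weak solution of `-u'' = μ u` belongs to the domain of the standard Laplacian. -/
theorem exists_isStandard_of_weak {u v : E → ℝ → ℂ} (h : Γ.IsSobolev u v) {μ : ℂ}
    (hw : ∀ φ ψ, Γ.IsSobolev φ ψ →
      ∑ e, ∫ x in 0..Γ.len e, starRingEnd ℂ (ψ e x) * v e x =
        μ * ∑ e, ∫ x in 0..Γ.len e, starRingEnd ℂ (φ e x) * u e x) :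
    ∃ u', Γ.IsStandard u u' (-μ • u) ∧
      ∀ e, v e =ᵐ[volume.restrict (Icc 0 (Γ.len e))] u' e := by
  classical
  have hU : ∀ e, HasSobolevDeriv (Γ.len e) (fun x => ∫ t in 0..x, u e t) (u e) := fun e =>
    ⟨(h.deriv e).memLp, fun x _ => by simp⟩
  -- Test functions supported on one edge and vanishing at its ends show that `v + μ ∫ u` is
  -- orthogonal to all their derivatives, hence constant; this is `v' = -μ u` in integrated form.
  have hγ : ∀ e, ∃ γ : ℂ, (fun x => v e x + μ * ∫ t in 0..x, u e t)
      =ᵐ[volume.restrict (Icc 0 (Γ.len e))] fun _ => γ := fun e => by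
    have hl := (Γ.len_pos e).le
    refine HasSobolevDeriv.ae_eq_const_of_forall_integral_eq_zero (Γ.len_pos e)
      ((h.deriv e).1.add ((hU e).memLp.const_mul μ)) fun φ ψ hφ h0 h1 => ?_
    have hs : Γ.IsSobolev (Pi.single e φ) (Pi.single e ψ) := by
      refine ⟨fun e' => ?_, 0, fun e' => ?_⟩
      · by_cases he : e' = e
        · subst he; simpa using hφ
        · simpa [he] using HasSobolevDeriv.zero _
      · by_cases he : e' = e
        · subst he; simp [h0, h1]
        · simp [he]
    have h2 := hw _ _ hs
    rw [Finset.sum_eq_single e (fun e' _ he => by simp [he]) (by simp),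
      Finset.sum_eq_single e (fun e' _ he => by simp [he]) (by simp)] at h2
    simp only [Pi.single_eq_same] at h2
    have hi1 : IntervalIntegrable (fun x => starRingEnd ℂ (ψ x) * v e x) volume 0 (Γ.len e) := by
      rw [intervalIntegrable_iff_integrableOn_Icc_of_le hl]
      exact hφ.conj.1.integrable_mul (h.deriv e).1
    have hi2 : IntervalIntegrable (fun x => starRingEnd ℂ (ψ x) * ∫ t in 0..x, u e t) volume 0
        (Γ.len e) := by
      rw [intervalIntegrable_iff_integrableOn_Icc_of_le hl]
      exact hφ.conj.1.integrable_mul (hU e).memLp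
    have hi3 : IntervalIntegrable (fun x => starRingEnd ℂ (φ x) * u e x) volume 0 (Γ.len e) := by
      rw [intervalIntegrable_iff_integrableOn_Icc_of_le hl]
      exact hφ.conj.memLp.integrable_mul (h.deriv e).memLp
    have h3 := hφ.conj.integral_mul_add_mul hl (hU e)
    rw [intervalIntegral.integral_add hi2 hi3, h0, h1] at h3
    simp only [map_zero, zero_mul, sub_zero] at h3
    simp only [mul_add, mul_left_comm _ μ]
    rw [intervalIntegral.integral_add hi1 (hi2.const_mul μ), intervalIntegral.integral_const_mul,
      h2, ← mul_add, add_comm, h3, mul_zero]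
  choose γ hγ using hγ
  let u' : E → ℝ → ℂ := fun e x => γ e - μ * ∫ t in 0..x, u e t
  have hu' : ∀ e, HasSobolevDeriv (Γ.len e) (u' e) ((-μ • u) e) := fun e => by
    have := (HasSobolevDeriv.const (Γ.len e) (γ e)).add ((hU e).smul (-μ))
    refine this.congr (fun x _ => ?_) (Filter.Eventually.of_forall fun x => ?_)
    · simp [u', sub_eq_add_neg]
    · simp
  have hvu : ∀ e, v e =ᵐ[volume.restrict (Icc 0 (Γ.len e))] u' e := fun e => by
    filter_upwards [hγ e] with x hx
    simp only [u', ← hx]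
    ring
  refine ⟨u', ⟨fun e => (h.deriv e).congr (fun _ _ => rfl) (hvu e).symm, hu', h.continuous,
    fun a => ?_⟩, hvu⟩
  -- The test function `φ` is affine on each edge, equal to `1` at the vertex `a` and to `0` at the
  -- other vertices (constant `1` on a loop at `a`). The boundary terms it produces are exactly the
  -- Kirchhoff sum at `a`.
  let A : E → ℂ := fun e => if Γ.src e = a then 1 else 0
  let B : E → ℂ := fun e => if Γ.tgt e = a then 1 else 0
  let ψ : E → ℝ → ℂ := fun e _ => (B e - A e) / Γ.len e
  let φ : E → ℝ → ℂ := fun e x => A e + (B e - A e) / Γ.len e * x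
  have hφ : Γ.IsSobolev φ ψ := by
    refine ⟨fun e => .of_hasDerivAt (fun x => ?_) continuous_const,
      fun b => if b = a then 1 else 0, fun e => ⟨?_, ?_⟩⟩
    · have := ((hasDerivAt_id x).ofReal_comp.const_mul ((B e - A e) / Γ.len e)).const_add (A e)
      rw [Complex.ofReal_one, mul_one] at this
      exact this
    · simp [φ, A]
    · have : (Γ.len e : ℂ) ≠ 0 := Complex.ofReal_ne_zero.2 (Γ.len_pos e).ne'
      simp [φ, A, B, this]
  have h4 := hw _ _ hφ
  rw [Finset.mul_sum, ← sub_eq_zero, ← Finset.sum_sub_distrib] at h4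
  rw [← neg_eq_zero, ← Finset.sum_neg_distrib]
  refine (Finset.sum_congr rfl fun e _ => ?_).trans h4
  have hl := (Γ.len_pos e).le
  have h5 := (hφ.deriv e).conj.integral_mul_add_mul hl (hu' e)
  have hi1 : IntervalIntegrable (fun x => starRingEnd ℂ (ψ e x) * u' e x) volume 0 (Γ.len e) := by
    rw [intervalIntegrable_iff_integrableOn_Icc_of_le hl]
    exact (hφ.deriv e).conj.1.integrable_mul (hu' e).memLp
  have hi2 : IntervalIntegrable (fun x => starRingEnd ℂ (φ e x) * (-μ • u) e x) volume 0
      (Γ.len e) := by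
    rw [intervalIntegrable_iff_integrableOn_Icc_of_le hl]
    exact (hφ.deriv e).conj.memLp.integrable_mul (hu' e).1
  rw [intervalIntegral.integral_add hi1 hi2] at h5
  have h6 : ∫ x in 0..Γ.len e, starRingEnd ℂ (φ e x) * (-μ • u) e x =
      -(μ * ∫ x in 0..Γ.len e, starRingEnd ℂ (φ e x) * u e x) := by
    rw [← intervalIntegral.integral_const_mul, ← intervalIntegral.integral_neg]
    refine intervalIntegral.integral_congr fun x _ => ?_
    simp
    ring
  have h7 : ∫ x in 0..Γ.len e, starRingEnd ℂ (ψ e x) * u' e x =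
      ∫ x in 0..Γ.len e, starRingEnd ℂ (ψ e x) * v e x := by
    rw [← HasSobolevDeriv.integral_Icc_eq hl, ← HasSobolevDeriv.integral_Icc_eq hl]
    refine integral_congr_ae ?_
    filter_upwards [hvu e] with x hx
    rw [hx]
  rw [h6, h7, ← sub_eq_add_neg] at h5
  rw [h5]
  have e1 : φ e 0 = A e := by simp [φ]
  have e2 : φ e (Γ.len e) = B e := by
    have : (Γ.len e : ℂ) ≠ 0 := Complex.ofReal_ne_zero.2 (Γ.len_pos e).ne'
    simp [φ, this]
  rw [e1, e2]
  simp only [A, B]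
  split_ifs <;> simp

theorem mem_eigenspace_iff {κ : ℝ} {f : Γ.L2} :
    f ∈ Γ.eigenspace κ ↔ (f, (κ : ℂ) • f) ∈ Γ.laplacianGraph := by
  rw [mem_eigenspace, ← graph_laplacian, LinearPMap.mem_graph_iff]
  constructor
  · rintro ⟨h, hf⟩
    exact ⟨⟨f, h⟩, rfl, hf⟩
  · rintro ⟨⟨g, hg⟩, rfl, h⟩
    exact ⟨hg, h⟩

theorem one_mem_eigenspace : Γ.one ∈ Γ.eigenspace 0 := by
  rw [mem_eigenspace_iff]
  refine ⟨fun _ _ => 1, 0, 0, ⟨fun _ => .const _ 1, fun _ => .zero _, ⟨fun _ => 1, by simp⟩,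
    by simp⟩, fun e => ⟨represents_one e, ?_⟩⟩
  simpa using Represents.zero (Γ := Γ) e

/-- The Euler–Lagrange equation `IsGapMinimizer.inner_eq` is the weak form of `-u'' = μ u`, to which
the regularity result `exists_isStandard_of_weak` applies. -/
theorem IsGapMinimizer.mem_eigenspace [Nonempty E] {μ : ℝ} {p : Γ.L2 × Γ.L2}
    (h : Γ.IsGapMinimizer μ p) : p.1 ∈ Γ.eigenspace μ := by
  obtain ⟨u, v, hs, hu, hv⟩ := h.mem
  obtain ⟨u', hst, -⟩ := exists_isStandard_of_weak (μ := μ) hs fun φ ψ k => by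
    obtain ⟨f, hf⟩ := exists_represents fun e => (k.deriv e).memLp
    obtain ⟨g, hg⟩ := exists_represents fun e => (k.deriv e).1
    have := h.inner_eq (q := (f, g)) ⟨φ, ψ, k, hf, hg⟩
    rwa [hg.inner_eq hv, hf.inner_eq hu] at this
  rw [mem_eigenspace_iff]
  refine ⟨u, u', _, hst, fun e => ⟨hu e, ?_⟩⟩
  refine (hu.smul (μ : ℂ) e).trans (Filter.Eventually.of_forall fun x => ?_)
  simp

/-- An eigenfunction of the standard Laplacian to an eigenvalue below the minimum of the Rayleigh
quotient over the functions with mean value zero is constant. -/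
theorem IsGapMinimizer.eigenspace_le_span_one [Finite V] [Nonempty E] {μ : ℝ} {p : Γ.L2 × Γ.L2}
    (h : Γ.IsGapMinimizer μ p) {κ : ℝ} (hκ : κ < μ) : Γ.eigenspace κ ≤ Submodule.span ℂ {Γ.one} := by
  intro f hf
  rw [mem_eigenspace_iff] at hf
  obtain ⟨u, u', u'', hst, hr⟩ := hf
  have hu : Γ.Represents f u := fun e => (hr e).1
  have hu'' : Γ.Represents ((-κ : ℂ) • f) u'' := by
    have h1 : Γ.Represents ((κ : ℂ) • f) (-u'') := fun e => (hr e).2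
    simpa using h1.smul (-1)
  obtain ⟨g, hg⟩ := exists_represents fun e => (hst.deriv_snd e).memLp
  have hs : Γ.IsSobolev u u' := ⟨hst.deriv_fst, hst.continuous⟩
  have hgreen : ∀ q ∈ Γ.sobolevGraph, inner ℂ q.2 g = κ * inner ℂ q.1 f := fun q hq => by
    obtain ⟨φ, ψ, k, hφ, hψ⟩ := hq
    have h1 := hst.sum_integral_eq k
    rw [← hψ.inner_eq hg, ← hφ.inner_eq hu'', inner_smul_right] at h1
    rw [h1]
    ring
  -- Testing with `1` gives `κ ⟨1, f⟩ = 0`; testing with `f` itself gives `‖f'‖ ^ 2 = κ ‖f‖ ^ 2`.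
  have h1 := hgreen _ one_mem_sobolevGraph
  have h2 := hgreen (f, g) ⟨u, u', hs, hu, hg⟩
  simp only [inner_zero_left, inner_self_eq_norm_sq_to_K] at h1 h2
  have h2' : ‖g‖ ^ 2 = κ * ‖f‖ ^ 2 := by
    refine Complex.ofReal_injective ?_
    simpa using h2
  have h3 := h.le_of_mem (q := (f, g)) ⟨u, u', hs, hu, hg⟩
  have hL := Γ.totalLength_pos
  let m : ℂ := inner ℂ Γ.one f / Γ.totalLength
  have hL' : (Γ.totalLength : ℂ) ≠ 0 := Complex.ofReal_ne_zero.2 hL.ne'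
  have h4 : inner ℂ Γ.one (f - m • Γ.one) = 0 := by
    rw [inner_sub_right, inner_smul_right, inner_one_one]
    simp [m, hL']
  have h5 : inner ℂ (f - m • Γ.one) (m • Γ.one) = 0 := by
    rw [inner_smul_right, ← inner_conj_symm, h4]
    simp
  -- Either `κ = 0` or `f` already has mean value zero. In both cases the mean-zero part of `f` has
  -- energy `κ` times its squared norm, which for `κ < μ` forces it to vanish.
  have h6 : κ * ‖f‖ ^ 2 = κ * ‖f - m • Γ.one‖ ^ 2 := by
    rcases mul_eq_zero.1 h1.symm with h7 | h7
    · rw [Complex.ofReal_eq_zero] at h7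
      simp [h7]
    · simp [m, h7]
  have h8 := h.le ((f, g) - m • (Γ.one, 0)) (Γ.sobolevGraph.sub_mem ⟨u, u', hs, hu, hg⟩
    (Γ.sobolevGraph.smul_mem m one_mem_sobolevGraph)) (by simpa using h4)
  simp only [Prod.fst_sub, Prod.snd_sub, Prod.smul_fst, Prod.smul_snd, smul_zero, sub_zero, h2',
    h6] at h8
  have h9 : ‖f - m • Γ.one‖ ^ 2 = 0 := by nlinarith [sq_nonneg ‖f - m • Γ.one‖]
  have h10 : f = m • Γ.one := by simpa [sub_eq_zero] using h9
  rw [h10]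
  exact Submodule.smul_mem _ _ (Submodule.mem_span_singleton_self _)

/-- The constant `1`, with eigenvalue `0 ≤ μ`, and the minimizer are orthogonal and nonzero, so
dimension two is reached at `μ`. For `ν < μ` all eigenspaces involved lie in the line of constants.
-/
theorem IsGapMinimizer.isNthEigenvalue_one [Finite V] [Nonempty E] {μ : ℝ} {p : Γ.L2 × Γ.L2}
    (h : Γ.IsGapMinimizer μ p) : Γ.IsNthEigenvalue 1 μ := by
  constructor
  · have h1 : Γ.one ∈ (⨆ κ : {κ : ℝ // κ ≤ μ}, Γ.eigenspace κ : Submodule ℂ Γ.L2) :=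
      Submodule.mem_iSup_of_mem (⟨0, h.nonneg⟩ : {κ : ℝ // κ ≤ μ}) one_mem_eigenspace
    have h2 : p.1 ∈ (⨆ κ : {κ : ℝ // κ ≤ μ}, Γ.eigenspace κ : Submodule ℂ Γ.L2) :=
      Submodule.mem_iSup_of_mem (⟨μ, le_rfl⟩ : {κ : ℝ // κ ≤ μ}) h.mem_eigenspace
    have h3 : LinearIndependent ℂ ![Γ.one, p.1] := by
      rw [LinearIndependent.pair_iff]
      intro s t hst
      have e1 := congrArg (inner ℂ Γ.one) hst
      rw [inner_add_right, inner_smul_right, inner_smul_right, inner_one_one, h.inner_one,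
        inner_zero_right, mul_zero, add_zero, mul_eq_zero, Complex.ofReal_eq_zero] at e1
      have hs : s = 0 := e1.resolve_right Γ.totalLength_pos.ne'
      subst hs
      simpa [h.ne_zero] using hst
    have h4 : LinearIndependent ℂ (![⟨Γ.one, h1⟩, ⟨p.1, h2⟩] :
        Fin 2 → (⨆ κ : {κ : ℝ // κ ≤ μ}, Γ.eigenspace κ : Submodule ℂ Γ.L2)) := by
      refine LinearIndependent.of_comp (Submodule.subtype _) ?_
      convert h3 using 1
      ext i
      fin_cases i <;> rfl
    have h5 := h4.cardinal_lift_le_rank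
    simp only [Cardinal.mk_fin, Cardinal.lift_natCast] at h5
    have h6 : ((2 : ℕ) : Cardinal) ≤ Module.rank ℂ
        (⨆ κ : {κ : ℝ // κ ≤ μ}, Γ.eigenspace κ : Submodule ℂ Γ.L2) := by
      simpa using h5
    have h7 : ((1 : ℕ) : Cardinal) + 1 = (2 : ℕ) := by norm_num
    exact h7.le.trans h6
  · intro ν hν
    have hν' : ((1 : ℕ) : Cardinal) + 1 ≤ Module.rank ℂ
        (⨆ κ : {κ : ℝ // κ ≤ ν}, Γ.eigenspace κ : Submodule ℂ Γ.L2) := hν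
    by_contra! hlt
    have h1 : (⨆ κ : {κ : ℝ // κ ≤ ν}, Γ.eigenspace κ : Submodule ℂ Γ.L2) ≤
        Submodule.span ℂ {Γ.one} :=
      iSup_le fun κ => h.eigenspace_le_span_one (κ.2.trans_lt hlt)
    have h2 := hν'.trans ((Submodule.rank_mono h1).trans (rank_span_le _))
    rw [Cardinal.mk_singleton] at h2
    norm_num at h2

end MetricGraph

/-! ### Closed walks through the doubled graph -/

namespace MetricGraph

variable {V E : Type*} (Γ : MetricGraph V E)

/-- The start vertex of an oriented edge. -/
def dartSrc (d : E × Bool) : V := if d.2 then Γ.src d.1 else Γ.tgt d.1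

/-- The end vertex of an oriented edge. -/
def dartTgt (d : E × Bool) : V := if d.2 then Γ.tgt d.1 else Γ.src d.1

/-- The list of oriented edges is a walk from `a` to `b`. -/
def IsWalk : V → List (E × Bool) → V → Prop
  | a, [], b => a = b
  | a, d :: l, b => Γ.dartSrc d = a ∧ IsWalk (Γ.dartTgt d) l b

variable {Γ}

theorem isWalk_append {a c : V} {l₁ l₂ : List (E × Bool)} :
    Γ.IsWalk a (l₁ ++ l₂) c ↔ ∃ b, Γ.IsWalk a l₁ b ∧ Γ.IsWalk b l₂ c := by
  induction l₁ generalizing a with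
  | nil => simp [IsWalk]
  | cons d l ih => simp [IsWalk, ih, and_assoc]

/-- In a connected graph there is a closed walk that runs through every edge exactly once in each
direction. -/
theorem Connected.exists_closed_walk [Finite E] (hΓ : Γ.Connected) :
    ∃ (a : V) (l : List (E × Bool)), Γ.IsWalk a l a ∧ l.Nodup ∧ ∀ d, d ∈ l := by
  classical
  have := Fintype.ofFinite E
  obtain ⟨a⟩ := hΓ.nonempty
  -- Closed walks at `a` that run through exactly the edges of `S`, once in each direction; `S` is
  -- then taken of maximal cardinality.
  let P : Finset E → Prop := fun S => ∃ l : List (E × Bool), Γ.IsWalk a l a ∧ l.Nodup ∧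
    ∀ d, d ∈ l ↔ d.1 ∈ S
  have hP : P ∅ := ⟨[], rfl, List.nodup_nil, by simp⟩
  obtain ⟨S, hS, hmax⟩ := (Set.toFinite {S | P S}).exists_maximalFor Finset.card _ ⟨∅, hP⟩
  obtain ⟨l, hl, hnd, hmem⟩ := hS
  -- The vertices visited by the walk. By maximality every edge at a visited vertex is used, so `W`
  -- is closed under adjacency and contains all vertices by connectedness.
  let W : Set V := {b | ∃ l₁ l₂, l = l₁ ++ l₂ ∧ Γ.IsWalk a l₁ b ∧ Γ.IsWalk b l₂ a}
  have haW : a ∈ W := ⟨[], l, rfl, rfl, hl⟩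
  have hins : ∀ d : E × Bool, Γ.dartSrc d ∈ W → d.1 ∈ S := by
    rintro ⟨e, s⟩ ⟨l₁, l₂, rfl, h1, h2⟩
    by_contra hd
    have hnot : ∀ t, (e, t) ∉ l₁ ++ l₂ := fun t ht => hd ((hmem (e, t)).1 ht)
    -- An unused edge at a visited vertex can be inserted into the walk as an excursion there and
    -- back, contradicting maximality.
    have hP' : P (insert e S) := by
      refine ⟨l₁ ++ ((e, s) :: (e, !s) :: l₂), ?_, ?_, fun d => ?_⟩
      · refine isWalk_append.2 ⟨_, h1, rfl, ?_, ?_⟩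
        · cases s <;> rfl
        · cases s <;> exact h2
      · have n1 := hnot s
        have n2 := hnot !s
        rw [List.mem_append, not_or] at n1 n2
        rw [List.nodup_append] at hnd ⊢
        refine ⟨hnd.1, ?_, ?_⟩
        · simp [n1.2, n2.2, hnd.2.1]
        · intro x hx y hy hxy
          subst hxy
          simp only [List.mem_cons] at hy
          rcases hy with rfl | rfl | hy
          · exact n1.1 hx
          · exact n2.1 hx
          · exact hnd.2.2 x hx x hy rfl
      · have := hmem d
        obtain ⟨e', t⟩ := d
        simp only [List.mem_append, List.mem_cons, Prod.mk.injEq, Finset.mem_insert] at this ⊢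
        rw [← this]
        cases s <;> cases t <;> simp <;> tauto
    have h3 := hmax hP' (by rw [Finset.card_insert_of_notMem hd]; omega)
    rw [Finset.card_insert_of_notMem hd] at h3
    omega
  have hstep : ∀ d : E × Bool, Γ.dartSrc d ∈ W → Γ.dartTgt d ∈ W := fun d hd => by
    obtain ⟨l₁, l₂, h1⟩ := List.append_of_mem ((hmem d).2 (hins d hd))
    rw [h1] at hl
    obtain ⟨b, h2, h3, h4⟩ := isWalk_append.1 hl
    refine ⟨l₁ ++ [d], l₂, by simp [h1], isWalk_append.2 ⟨b, h2, h3, rfl⟩, h4⟩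
  have hadj : ∀ b c, (SimpleGraph.fromRel fun v w => ∃ e, Γ.src e = v ∧ Γ.tgt e = w).Adj b c →
      b ∈ W → c ∈ W := by
    rintro b c ⟨-, ⟨e, rfl, rfl⟩ | ⟨e, rfl, rfl⟩⟩ hb
    · exact hstep (e, true) hb
    · exact hstep (e, false) hb
  have hall : ∀ b, b ∈ W := fun b => by
    obtain ⟨w⟩ := hΓ.preconnected a b
    have hwalk : ∀ {x y : V} (_ : (SimpleGraph.fromRel fun v w =>
        ∃ e, Γ.src e = v ∧ Γ.tgt e = w).Walk x y), x ∈ W → y ∈ W := by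
      intro x y w
      induction w with
      | nil => exact id
      | cons h _ ih => exact fun hx => ih (hadj _ _ h hx)
    exact hwalk w haW
  exact ⟨a, l, hl, hnd, fun d => (hmem d).2 (hins d (hall _))⟩

/-- A Sobolev function on a graph can be read off along a walk. -/
theorem IsWalk.exists_sobolev {u v : E → ℝ → ℂ}
    (hd : ∀ e, HasSobolevDeriv (Γ.len e) (u e) (v e)) {c : V → ℂ}
    (hc : ∀ e, u e 0 = c (Γ.src e) ∧ u e (Γ.len e) = c (Γ.tgt e)) {a b : V}
    {l : List (E × Bool)} (hl : Γ.IsWalk a l b) :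
    ∃ F F' : ℝ → ℂ, HasSobolevDeriv (l.map fun d => Γ.len d.1).sum F F' ∧ F 0 = c a ∧
      F (l.map fun d => Γ.len d.1).sum = c b ∧
      ∫ x in 0..(l.map fun d => Γ.len d.1).sum, F x =
        (l.map fun d => ∫ x in 0..Γ.len d.1, u d.1 x).sum ∧
      ∫ x in 0..(l.map fun d => Γ.len d.1).sum, ‖F x‖ ^ 2 =
        (l.map fun d => ∫ x in 0..Γ.len d.1, ‖u d.1 x‖ ^ 2).sum ∧
      ∫ x in 0..(l.map fun d => Γ.len d.1).sum, ‖F' x‖ ^ 2 =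
        (l.map fun d => ∫ x in 0..Γ.len d.1, ‖v d.1 x‖ ^ 2).sum := by
  induction l generalizing a with
  | nil =>
    obtain rfl : a = b := hl
    exact ⟨fun _ => c a, 0, .const _ _, rfl, rfl, by simp, by simp, by simp⟩
  | cons d l ih =>
    obtain ⟨rfl, hl⟩ := hl
    obtain ⟨F, F', h, h0, h1, e1, e2, e3⟩ := ih hl
    have hdart : ∃ G G' : ℝ → ℂ, HasSobolevDeriv (Γ.len d.1) G G' ∧ G 0 = c (Γ.dartSrc d) ∧
        G (Γ.len d.1) = c (Γ.dartTgt d) ∧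
        ∫ x in 0..Γ.len d.1, G x = ∫ x in 0..Γ.len d.1, u d.1 x ∧
        ∫ x in 0..Γ.len d.1, ‖G x‖ ^ 2 = ∫ x in 0..Γ.len d.1, ‖u d.1 x‖ ^ 2 ∧
        ∫ x in 0..Γ.len d.1, ‖G' x‖ ^ 2 = ∫ x in 0..Γ.len d.1, ‖v d.1 x‖ ^ 2 := by
      obtain ⟨e, s⟩ := d
      cases s
      · refine ⟨_, _, (hd e).reverse (Γ.len_pos e).le, ?_, ?_, ?_, ?_, ?_⟩
        · simpa [dartSrc] using (hc e).2
        · simpa [dartTgt] using (hc e).1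
        · simp
        · simpa using intervalIntegral.integral_comp_sub_left (a := 0) (b := Γ.len e)
            (fun x => ‖u e x‖ ^ 2) (Γ.len e)
        · simpa using intervalIntegral.integral_comp_sub_left (a := 0) (b := Γ.len e)
            (fun x => ‖v e x‖ ^ 2) (Γ.len e)
      · exact ⟨_, _, hd e, (hc e).1, (hc e).2, rfl, rfl, rfl⟩
    obtain ⟨G, G', k, k0, k1, g1, g2, g3⟩ := hdart
    have ha : 0 ≤ Γ.len d.1 := (Γ.len_pos d.1).le
    have hb : 0 ≤ (l.map fun d => Γ.len d.1).sum :=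
      List.sum_nonneg (by simp only [List.mem_map]; rintro _ ⟨d, -, rfl⟩; exact (Γ.len_pos _).le)
    have hGF : G (Γ.len d.1) = F 0 := by rw [k1, h0]
    have hsq : ∀ (p q : ℝ → ℂ), (fun x => ‖if x ≤ Γ.len d.1 then p x else q (x - Γ.len d.1)‖ ^ 2) =
        fun x => if x ≤ Γ.len d.1 then ‖p x‖ ^ 2 else ‖q (x - Γ.len d.1)‖ ^ 2 := fun p q => by
      funext x
      split_ifs <;> rfl
    have hint : ∀ {T : ℝ} {p q : ℝ → ℂ}, 0 ≤ T → HasSobolevDeriv T p q →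
        IntervalIntegrable p volume 0 T := fun hT hp => by
      rw [intervalIntegrable_iff_integrableOn_Icc_of_le hT]
      exact hp.memLp.integrable (by norm_num)
    simp only [List.map_cons, List.sum_cons]
    refine ⟨_, _, k.concat ha h hGF, ?_, ?_, ?_, ?_, ?_⟩
    · simp [ha, k0]
    -- If the rest of the walk has length zero, the end point falls into the first branch `x ≤ Γ.len
    -- d.1` of the concatenation.
    · by_cases hT : (l.map fun d => Γ.len d.1).sum ≤ 0
      · have hT' := le_antisymm hT hb
        rw [hT'] at h1
        simp [hT', hGF, h1]
      · simpa [hT] using h1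
    · rw [(intervalIntegral_concat ha hb (hint ha k) (hint hb h)).2, g1, e1]
    · rw [hsq, (intervalIntegral_concat ha hb
        (HasSobolevDeriv.intervalIntegrable_norm_sq ha k.memLp)
        (HasSobolevDeriv.intervalIntegrable_norm_sq hb h.memLp)).2, g2, e2]
    · rw [hsq, (intervalIntegral_concat ha hb
        (HasSobolevDeriv.intervalIntegrable_norm_sq ha k.1)
        (HasSobolevDeriv.intervalIntegrable_norm_sq hb h.1)).2, g3, e3]

end MetricGraph

/-! ### Wirtinger's inequality by a Riccati comparison -/

namespace HasSobolevDeriv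

variable {T : ℝ} {g g' : ℝ → ℝ}

/-- A Riccati estimate: comparison of the Rayleigh quotient with the equation `τ' = -κ² - τ²`
solved by `τ = -κ tan (κ (t - m))`. -/
theorem sq_mul_integral_sq_add_le (h : HasSobolevDeriv T (fun x => (g x : ℂ)) fun x => (g' x : ℂ))
    {a b κ m : ℝ} (ha : 0 ≤ a) (hab : a ≤ b) (hb : b ≤ T)
    (hm : ∀ t ∈ Icc a b, |κ * (t - m)| < Real.pi / 2) :
    κ ^ 2 * (∫ x in a..b, g x ^ 2) + (g a ^ 2 * (κ * Real.tan (κ * (a - m))) -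
      g b ^ 2 * (κ * Real.tan (κ * (b - m)))) ≤ ∫ x in a..b, g' x ^ 2 := by
  have hT : 0 ≤ T := ha.trans (hab.trans hb)
  have haT : a ∈ Icc 0 T := ⟨ha, hab.trans hb⟩
  have hbT : b ∈ Icc 0 T := ⟨ha.trans hab, hb⟩
  have hsub : uIcc a b ⊆ uIcc 0 T := by
    rw [uIcc_of_le hab, uIcc_of_le hT]
    exact Icc_subset_Icc ha hb
  have hgc : ContinuousOn g (uIcc 0 T) := by
    have := Complex.continuous_re.comp_continuousOn h.continuousOn'
    rw [uIcc_of_le hT]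
    simpa [Function.comp_def] using this
  have hg'i : IntervalIntegrable g' volume 0 T := by
    have := (intervalIntegrable_iff.1 (h.intervalIntegrable (right_mem_Icc.2 hT))).re
    exact intervalIntegrable_iff.2 this
  have hg'2 : IntervalIntegrable (fun x => g' x ^ 2) volume 0 T := by
    simpa using intervalIntegrable_norm_sq hT h.1
  have hgc' := hgc.mono hsub
  have hg'i' := hg'i.mono_set hsub
  have hg'2' := hg'2.mono_set hsub
  -- `w` is the derivative of `τ`, written as the right-hand side `-(κ ^ 2 + τ ^ 2)` of the Riccati
  -- equation.
  let w : ℝ → ℝ := fun x => -(κ ^ 2 + (κ * Real.tan (κ * (x - m))) ^ 2)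
  let τ : ℝ → ℝ := fun x => -(κ * Real.tan (κ * (x - m)))
  have hcos : ∀ x ∈ uIcc a b, Real.cos (κ * (x - m)) ≠ 0 := fun x hx => by
    rw [uIcc_of_le hab] at hx
    have := abs_lt.1 (hm x hx)
    exact (Real.cos_pos_of_mem_Ioo ⟨by linarith, this.2⟩).ne'
  have hτd : ∀ x ∈ uIcc a b, HasDerivAt τ (w x) x := fun x hx => by
    have h1 : HasDerivAt (fun x => κ * (x - m)) (κ * 1) x :=
      ((hasDerivAt_id x).sub_const m).const_mul κ
    have h2 := ((Real.hasDerivAt_tan (hcos x hx)).comp x h1).const_mul κ |>.neg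
    refine HasDerivAt.congr_deriv (f := τ) h2 ?_
    simp only [w, Real.tan_eq_sin_div_cos]
    have := hcos x hx
    have h3 := Real.sin_sq_add_cos_sq (κ * (x - m))
    field_simp
    linear_combination κ ^ 2 * h3
  have hτc : ContinuousOn τ (uIcc a b) := fun x hx => (hτd x hx).continuousAt.continuousWithinAt
  have hwc : ContinuousOn w (uIcc a b) := by
    have : ∀ x, w x = -(κ ^ 2 + τ x ^ 2) := fun x => by simp [w, τ]
    exact ContinuousOn.congr (by fun_prop) fun x _ => this x
  have hτ : ∀ x ∈ uIcc a b, τ a + ∫ t in a..x, w t = τ x := fun x hx => by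
    rw [intervalIntegral.integral_eq_sub_of_hasDerivAt
      (fun y hy => hτd y (uIcc_subset_uIcc_left hx hy))
      ((hwc.mono (uIcc_subset_uIcc_left hx)).intervalIntegrable)]
    ring
  have hgg : ∀ x ∈ uIcc a b, g a ^ 2 + ∫ t in a..x, 2 * (g t * g' t) = g x ^ 2 := fun x hx => by
    rw [uIcc_of_le hab] at hx
    have h1 := (h.mul h).integral_eq_sub haT ⟨ha.trans hx.1, hx.2.trans hb⟩
    have h2 : ∀ t, (g' t : ℂ) * g t + g t * g' t = ((2 * (g t * g' t) : ℝ) : ℂ) := fun t => by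
      push_cast; ring
    simp only [h2, intervalIntegral.integral_ofReal] at h1
    have h3 : ∫ t in a..x, 2 * (g t * g' t) = g x * g x - g a * g a := by exact_mod_cast h1
    rw [h3]
    ring
  have hggi : IntervalIntegrable (fun x => 2 * (g x * g' x)) volume a b :=
    (hg'i'.continuousOn_mul hgc').const_mul 2
  have key := integral_primitive_mul_add_mul_primitive (g a ^ 2) (τ a) hggi hwc.intervalIntegrable
  rw [hτ b right_mem_uIcc, hgg b right_mem_uIcc] at key
  have key2 : ∫ x in a..b, (2 * (g x * g' x) * τ x + g x ^ 2 * w x) =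
      g b ^ 2 * τ b - g a ^ 2 * τ a := by
    rw [← key]
    refine intervalIntegral.integral_congr fun x hx => ?_
    simp only [hτ x hx, hgg x hx]
  have hi1 : IntervalIntegrable (fun x => 2 * (g x * g' x) * τ x + g x ^ 2 * w x) volume a b :=
    (hggi.mul_continuousOn hτc).add ((hgc'.pow 2).mul hwc).intervalIntegrable
  have hi2 : IntervalIntegrable (fun x => κ ^ 2 * g x ^ 2) volume a b :=
    ((hgc'.pow 2).intervalIntegrable).const_mul _
  -- Completing the square: by the Riccati equation, `(g' - g τ) ^ 2 = g' ^ 2 - (g ^ 2 τ)' - κ ^ 2 g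
  -- ^ 2`.
  have hpos : 0 ≤ ∫ x in a..b, (g' x - g x * τ x) ^ 2 :=
    intervalIntegral.integral_nonneg hab fun x _ => sq_nonneg _
  have hexp : ∫ x in a..b, (g' x - g x * τ x) ^ 2 = (∫ x in a..b, g' x ^ 2) -
      (∫ x in a..b, (2 * (g x * g' x) * τ x + g x ^ 2 * w x)) -
      ∫ x in a..b, κ ^ 2 * g x ^ 2 := by
    rw [← intervalIntegral.integral_sub hg'2' hi1, ← intervalIntegral.integral_sub
      (hg'2'.sub hi1) hi2]
    refine intervalIntegral.integral_congr fun x _ => ?_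
    simp only [w, τ]
    ring
  rw [hexp, key2, intervalIntegral.integral_const_mul] at hpos
  simp only [τ] at hpos
  linarith

/-- **Wirtinger's inequality** for real functions with equal values at the end points. -/
theorem wirtinger {L κ : ℝ} (hL : 0 < L) (hκ : 0 ≤ κ) (hκL : κ * L < Real.pi)
    (h : HasSobolevDeriv (2 * L) (fun x => (g x : ℂ)) fun x => (g' x : ℂ))
    (hper : g 0 = g (2 * L)) (hmean : ∫ x in 0..(2 * L), g x = 0) :
    κ ^ 2 * (∫ x in 0..(2 * L), g x ^ 2) ≤ ∫ x in 0..(2 * L), g' x ^ 2 := by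
  have hgc : ContinuousOn g (Icc 0 (2 * L)) := by
    have := Complex.continuous_re.comp_continuousOn h.continuousOn'
    simpa [Function.comp_def] using this
  -- On the circle of length `2 * L` some pair of antipodal points has equal values: `g (t + L) - g
  -- t` takes opposite values at `t = 0` and `t = L`. Subtracting the common value `c` leaves a
  -- function vanishing at the ends of two arcs of length `L`.
  obtain ⟨t₀, ht, htc⟩ : ∃ t ∈ Icc 0 L, g (t + L) = g t := by
    have hc : ContinuousOn (fun t => g (t + L) - g t) (uIcc 0 L) := by
      rw [uIcc_of_le hL.le]
      refine ContinuousOn.sub (hgc.comp (by fun_prop) fun t ht => ?_) (hgc.mono fun t ht => ?_)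
      · exact ⟨by linarith [ht.1], by linarith [ht.2]⟩
      · exact ⟨ht.1, by linarith [ht.2]⟩
    have h0 : (0 : ℝ) ∈ uIcc (g (0 + L) - g 0) (g (L + L) - g L) := by
      rw [zero_add, ← two_mul, ← hper, mem_uIcc]
      rcases le_total (g L) (g 0) with h | h
      · exact Or.inl ⟨by linarith, by linarith⟩
      · exact Or.inr ⟨by linarith, by linarith⟩
    obtain ⟨t, ht, h1⟩ := intermediate_value_uIcc hc h0
    rw [uIcc_of_le hL.le] at ht
    exact ⟨t, ht, sub_eq_zero.1 h1⟩
  let c := g t₀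
  let f : ℝ → ℝ := fun x => g x - c
  have hf : HasSobolevDeriv (2 * L) (fun x => (f x : ℂ)) fun x => (g' x : ℂ) := by
    refine (h.add (HasSobolevDeriv.const _ (-c : ℂ))).congr (fun x _ => ?_)
      (Filter.Eventually.of_forall fun x => ?_)
    · simp [f, sub_eq_add_neg]
    · simp
  have hmid : ∀ {a b m : ℝ}, m - L / 2 ≤ a → b ≤ m + L / 2 →
      ∀ t ∈ Icc a b, |κ * (t - m)| < Real.pi / 2 := fun {a b m} ha hb t ht => by
    rw [abs_mul, abs_of_nonneg hκ]
    have h1 : |t - m| ≤ L / 2 := abs_le.2 ⟨by linarith [ht.1], by linarith [ht.2]⟩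
    nlinarith
  -- Each arc is compared with the tangent centred at its midpoint, which is finite on the closed
  -- arc because `κ * L < π`. The arc through the base point is cut into `[0, t₀]` and `[t₀ + L, 2 *
  -- L]`; by periodicity and `f4` the boundary terms at `0` and `2 * L` cancel.
  have i1 := hf.sq_mul_integral_sq_add_le (κ := κ) (m := t₀ - L / 2) le_rfl ht.1
    (by linarith [ht.2]) (hmid (by linarith [ht.2]) (by linarith))
  have i2 := hf.sq_mul_integral_sq_add_le (a := t₀) (b := t₀ + L) (κ := κ) (m := t₀ + L / 2) ht.1
    (by linarith) (by linarith [ht.2]) (hmid (by linarith) (by linarith))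
  have i3 := hf.sq_mul_integral_sq_add_le (a := t₀ + L) (b := 2 * L) (κ := κ) (m := t₀ + 3 * L / 2)
    (by linarith [ht.1]) (by linarith [ht.2]) le_rfl (hmid (by linarith) (by linarith [ht.1]))
  have f1 : f t₀ = 0 := sub_self _
  have f2 : f (t₀ + L) = 0 := by simp [f, c, htc]
  have f3 : f (2 * L) = f 0 := by simp [f, hper]
  have f4 : 2 * L - (t₀ + 3 * L / 2) = 0 - (t₀ - L / 2) := by ring
  rw [f1] at i1
  rw [f1, f2] at i2
  rw [f2, f3, f4] at i3
  have hsum : ∀ {p : ℝ → ℝ}, IntervalIntegrable p volume 0 (2 * L) →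
      ∫ x in 0..(2 * L), p x = (∫ x in 0..t₀, p x) + (∫ x in t₀..(t₀ + L), p x) +
        ∫ x in (t₀ + L)..(2 * L), p x := fun {p} hp => by
    have hm : ∀ {a b : ℝ}, a ∈ Icc 0 (2 * L) → b ∈ Icc 0 (2 * L) →
        IntervalIntegrable p volume a b := fun ha hb => hp.mono_set (by
      rw [uIcc_of_le (by linarith : (0 : ℝ) ≤ 2 * L)]
      exact uIcc_subset_Icc ha hb)
    have a0 : (0 : ℝ) ∈ Icc 0 (2 * L) := ⟨le_rfl, by linarith⟩
    have a1 : t₀ ∈ Icc 0 (2 * L) := ⟨ht.1, by linarith [ht.2]⟩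
    have a2 : t₀ + L ∈ Icc 0 (2 * L) := ⟨by linarith [ht.1], by linarith [ht.2]⟩
    have a3 : 2 * L ∈ Icc 0 (2 * L) := ⟨by linarith, le_rfl⟩
    rw [intervalIntegral.integral_add_adjacent_intervals (hm a0 a1) (hm a1 a2),
      intervalIntegral.integral_add_adjacent_intervals (hm a0 a2) (hm a2 a3)]
  have hL2 : (0 : ℝ) ≤ 2 * L := by linarith
  have hg'2 : IntervalIntegrable (fun x => g' x ^ 2) volume 0 (2 * L) := by
    simpa using intervalIntegrable_norm_sq hL2 h.1
  have hf2 : IntervalIntegrable (fun x => f x ^ 2) volume 0 (2 * L) := by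
    simpa using intervalIntegrable_norm_sq hL2 hf.memLp
  have hg2 : IntervalIntegrable (fun x => g x ^ 2) volume 0 (2 * L) := by
    simpa using intervalIntegrable_norm_sq hL2 h.memLp
  have hg1 : IntervalIntegrable g volume 0 (2 * L) := by
    rw [← uIcc_of_le hL2] at hgc
    exact hgc.intervalIntegrable
  -- Since `g` has mean value zero, subtracting `c` only increases the squared norm, which is in the
  -- favourable direction.
  have hfg : ∫ x in 0..(2 * L), f x ^ 2 = (∫ x in 0..(2 * L), g x ^ 2) + 2 * L * c ^ 2 := by
    have e : ∀ x, f x ^ 2 = g x ^ 2 - 2 * c * g x + c ^ 2 := fun x => by simp only [f]; ring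
    simp only [e]
    rw [intervalIntegral.integral_add (hg2.sub (hg1.const_mul _)) (by simp),
      intervalIntegral.integral_sub hg2 (hg1.const_mul _), intervalIntegral.integral_const_mul,
      hmean, intervalIntegral.integral_const]
    simp
  have hpos : 0 ≤ κ ^ 2 * (2 * L * c ^ 2) := by positivity
  have s1 := hsum hf2
  have s2 := hsum hg'2
  rw [hfg] at s1
  have s3 : κ ^ 2 * (∫ x in 0..(2 * L), g x ^ 2) + κ ^ 2 * (2 * L * c ^ 2) =
      κ ^ 2 * (∫ x in 0..t₀, f x ^ 2) + κ ^ 2 * (∫ x in t₀..(t₀ + L), f x ^ 2) +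
        κ ^ 2 * ∫ x in (t₀ + L)..(2 * L), f x ^ 2 := by
    rw [← mul_add, s1]; ring
  rw [s2]
  linarith

/-- **Wirtinger's inequality** for functions with equal values at the end points. -/
theorem wirtinger_complex {L κ : ℝ} (hL : 0 < L) (hκ : 0 ≤ κ) (hκL : κ * L < Real.pi)
    {F F' : ℝ → ℂ} (h : HasSobolevDeriv (2 * L) F F') (hper : F 0 = F (2 * L))
    (hmean : ∫ x in 0..(2 * L), F x = 0) :
    κ ^ 2 * (∫ x in 0..(2 * L), ‖F x‖ ^ 2) ≤ ∫ x in 0..(2 * L), ‖F' x‖ ^ 2 := by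
  have hL2 : (0 : ℝ) ≤ 2 * L := by linarith
  have hFi : IntervalIntegrable F volume 0 (2 * L) := by
    rw [intervalIntegrable_iff_integrableOn_Icc_of_le hL2]
    exact h.memLp.integrable (by norm_num)
  have m1 : ∫ x in 0..(2 * L), (F x).re = 0 := by
    have := Complex.reCLM.intervalIntegral_comp_comm hFi
    rw [hmean] at this
    simpa using this
  have m2 : ∫ x in 0..(2 * L), (F x).im = 0 := by
    have := Complex.imCLM.intervalIntegral_comp_comm hFi
    rw [hmean] at this
    simpa using this
  have w1 := wirtinger hL hκ hκL h.re (by rw [hper]) m1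
  have w2 := wirtinger hL hκ hκL h.im (by rw [hper]) m2
  have hn : ∀ {p : ℝ → ℂ}, MemLp (fun x => ((p x).re : ℂ)) 2 (volume.restrict (Icc 0 (2 * L))) →
      MemLp (fun x => ((p x).im : ℂ)) 2 (volume.restrict (Icc 0 (2 * L))) →
      ∫ x in 0..(2 * L), ‖p x‖ ^ 2 =
        (∫ x in 0..(2 * L), (p x).re ^ 2) + ∫ x in 0..(2 * L), (p x).im ^ 2 := fun hr hi => by
    rw [← intervalIntegral.integral_add (by simpa using intervalIntegrable_norm_sq hL2 hr)
      (by simpa using intervalIntegrable_norm_sq hL2 hi)]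
    refine intervalIntegral.integral_congr fun x _ => ?_
    simp only [Complex.sq_norm, Complex.normSq_apply]
    ring
  rw [hn h.re.memLp h.im.memLp, hn h.re.1 h.im.1]
  linarith

end HasSobolevDeriv

/-! ### The lower bound for the first nonzero eigenvalue of a connected graph -/

namespace MetricGraph

variable {V E : Type*} [Fintype E] {Γ : MetricGraph V E}

/-- The Poincaré inequality on a connected metric graph: the first nonzero eigenvalue is at least
`κ ^ 2` for every `κ < π / L`, where `L` is the total length. -/
theorem Connected.sq_mul_norm_sq_le [Nonempty E] (hΓ : Γ.Connected) {κ : ℝ} (hκ : 0 ≤ κ)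
    (hκL : κ * Γ.totalLength < Real.pi) {q : Γ.L2 × Γ.L2} (hq : q ∈ Γ.sobolevGraph)
    (hmean : inner ℂ Γ.one q.1 = 0) : κ ^ 2 * ‖q.1‖ ^ 2 ≤ ‖q.2‖ ^ 2 := by
  classical
  obtain ⟨u, v, hs, hu, hv⟩ := hq
  obtain ⟨c, hc⟩ := hs.continuous
  obtain ⟨a, l, hl, hnd, hmem⟩ := hΓ.exists_closed_walk
  -- Each edge occurs exactly twice in the walk, so lengths, mean values, norms and energies are all
  -- doubled.
  have hsum : ∀ {M : Type} [AddCommMonoid M] (r : E → M),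
      (l.map fun d => r d.1).sum = (∑ e, r e) + ∑ e, r e := fun r => by
    rw [← List.sum_toFinset _ hnd, show l.toFinset = Finset.univ from
      Finset.eq_univ_iff_forall.2 fun d => List.mem_toFinset.2 (hmem d), Fintype.sum_prod_type]
    simp [two_nsmul, Finset.sum_add_distrib]
  obtain ⟨F, F', h, h0, h1, e1, e2, e3⟩ := hl.exists_sobolev hs.deriv hc
  rw [hsum fun e => ∫ x in 0..Γ.len e, u e x] at e1
  rw [hsum fun e => ∫ x in 0..Γ.len e, ‖u e x‖ ^ 2] at e2
  rw [hsum fun e => ∫ x in 0..Γ.len e, ‖v e x‖ ^ 2] at e3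
  rw [hsum Γ.len, ← two_mul] at h h1 e1 e2 e3
  rw [← hu.inner_one, hmean, add_zero] at e1
  rw [← hu.norm_sq_eq] at e2
  rw [← hv.norm_sq_eq] at e3
  have := HasSobolevDeriv.wirtinger_complex totalLength_pos hκ hκL h (by rw [h0]; exact h1.symm) e1
  change κ ^ 2 * (∫ x in 0..(2 * ∑ e, Γ.len e), ‖F x‖ ^ 2) ≤
    ∫ x in 0..(2 * ∑ e, Γ.len e), ‖F' x‖ ^ 2 at this
  rw [e2, e3] at this
  linarith

end MetricGraph

/-! ### Extension of a function to the new edge -/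

/-- On an interval of length `ℓ` every pair of end values is attained by a Sobolev function whose
mean value is the average of the end values and whose oscillating part has the Rayleigh quotient
`(π / ℓ) ^ 2`. -/
theorem HasSobolevDeriv.exists_cos_interpolation {ℓ : ℝ} (hℓ : 0 < ℓ) (a b : ℂ) :
    ∃ g g' : ℝ → ℂ, HasSobolevDeriv ℓ g g' ∧ g 0 = a ∧ g ℓ = b ∧
      ∫ x in 0..ℓ, g x = ℓ * ((a + b) / 2) ∧
      ∫ x in 0..ℓ, ‖g x‖ ^ 2 = ℓ * ‖(a + b) / 2‖ ^ 2 + ℓ / 2 * ‖(b - a) / 2‖ ^ 2 ∧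
      ∫ x in 0..ℓ, ‖g' x‖ ^ 2 = (Real.pi / ℓ) ^ 2 * (ℓ / 2 * ‖(b - a) / 2‖ ^ 2) := by
  set s : ℂ := (a + b) / 2 with hs
  set d : ℂ := (b - a) / 2 with hd
  set k : ℝ := Real.pi / ℓ with hk
  have hk0 : k ≠ 0 := (div_pos Real.pi_pos hℓ).ne'
  have hkℓ : k * ℓ = Real.pi := div_mul_cancel₀ _ hℓ.ne'
  -- The first nonconstant Neumann eigenfunction of the interval, rising from `-1` to `1`; the
  -- interpolant is `s + d w`.
  let w : ℝ → ℝ := fun x => -Real.cos (k * x)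
  let w' : ℝ → ℝ := fun x => Real.sin (k * x) * k
  have hw : ∀ x, HasDerivAt w (w' x) x := fun x => by
    have h1 : HasDerivAt (fun x : ℝ => k * x) k x := by
      simpa using (hasDerivAt_id x).const_mul k
    exact HasDerivAt.congr_deriv (f := w) h1.cos.neg (by simp [w'])
  have hwc : Continuous w := by fun_prop
  have hw'c : Continuous w' := by fun_prop
  have e1 : ∫ x in 0..ℓ, w x = 0 := by
    simp only [w, intervalIntegral.integral_neg]
    rw [intervalIntegral.integral_comp_mul_left (fun x => Real.cos x) hk0]
    simp [hkℓ]
  have e2 : ∫ x in 0..ℓ, w x ^ 2 = ℓ / 2 := by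
    simp only [w, neg_sq]
    rw [intervalIntegral.integral_comp_mul_left (fun x => Real.cos x ^ 2) hk0, integral_cos_sq,
      hkℓ]
    simp [hk]
    field_simp
  have e3 : ∫ x in 0..ℓ, w' x ^ 2 = k ^ 2 * (ℓ / 2) := by
    simp only [w', mul_pow]
    rw [intervalIntegral.integral_mul_const,
      intervalIntegral.integral_comp_mul_left (fun x => Real.sin x ^ 2) hk0, integral_sin_sq, hkℓ]
    simp [hk]
    field_simp
  refine ⟨fun x => s + d * w x, fun x => d * w' x,
    .of_hasDerivAt (fun x => ?_) (by fun_prop), ?_, ?_, ?_, ?_, ?_⟩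
  · exact ((hw x).ofReal_comp.const_mul d).const_add s
  · simp [w, hs, hd]; ring
  · simp [w, hkℓ, hs, hd]; ring
  · have hi : Continuous fun x => d * (w x : ℂ) := by fun_prop
    rw [intervalIntegral.integral_add (by simp) (hi.intervalIntegrable _ _),
      intervalIntegral.integral_const_mul, intervalIntegral.integral_ofReal, e1]
    simp
  · have h1 : ∀ x, ‖s + d * w x‖ ^ 2 =
        ‖s‖ ^ 2 + 2 * (s * starRingEnd ℂ d).re * w x + ‖d‖ ^ 2 * w x ^ 2 := fun x => by
      simp only [Complex.sq_norm, Complex.normSq_apply, Complex.add_re, Complex.add_im,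
        Complex.mul_re, Complex.mul_im, Complex.ofReal_re, Complex.ofReal_im, Complex.conj_re,
        Complex.conj_im]
      ring
    simp only [h1]
    have c1 : Continuous fun x => 2 * (s * starRingEnd ℂ d).re * w x := by fun_prop
    have c2 : Continuous fun x => ‖s‖ ^ 2 + 2 * (s * starRingEnd ℂ d).re * w x := by fun_prop
    have c3 : Continuous fun x => ‖d‖ ^ 2 * w x ^ 2 := by fun_prop
    rw [intervalIntegral.integral_add (c2.intervalIntegrable _ _) (c3.intervalIntegrable _ _),
      intervalIntegral.integral_add (by simp) (c1.intervalIntegrable _ _),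
      intervalIntegral.integral_const_mul, intervalIntegral.integral_const_mul, e1, e2]
    simp
    ring
  · have h1 : ∀ x, ‖d * (w' x : ℂ)‖ ^ 2 = ‖d‖ ^ 2 * w' x ^ 2 := fun x => by
      rw [norm_mul, mul_pow, Complex.norm_real, Real.norm_eq_abs, sq_abs]
    simp only [h1, intervalIntegral.integral_const_mul, e3]
    ring

namespace MetricGraph

variable {V E : Type*} [Fintype E] {Γ : MetricGraph V E}

theorem totalLength_addEdge (v₁ v₂ : V) {ℓ : ℝ} (hℓ : 0 < ℓ) :
    (Γ.addEdge v₁ v₂ ℓ hℓ).totalLength = ℓ + Γ.totalLength := by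
  simp [totalLength, addEdge, Fintype.sum_option]

/-- A Sobolev function `q.1` on `Γ` with mean value zero extends to the new edge in such a way that
the Rayleigh quotient does not increase. -/
theorem exists_extension_addEdge (v₁ v₂ : V) {ℓ : ℝ} (hℓ : 0 < ℓ) {q : Γ.L2 × Γ.L2}
    (hq : q ∈ Γ.sobolevGraph) (hmean : inner ℂ Γ.one q.1 = 0) :
    ∃ r ∈ (Γ.addEdge v₁ v₂ ℓ hℓ).sobolevGraph, ∃ s d : ℂ,
      inner ℂ (Γ.addEdge v₁ v₂ ℓ hℓ).one r.1 = ℓ * s ∧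
      ‖r.1‖ ^ 2 = ‖q.1‖ ^ 2 + ℓ * ‖s‖ ^ 2 + ℓ / 2 * ‖d‖ ^ 2 ∧
      ‖r.2‖ ^ 2 = ‖q.2‖ ^ 2 + (Real.pi / ℓ) ^ 2 * (ℓ / 2 * ‖d‖ ^ 2) := by
  obtain ⟨u, v, hs, hu, hv⟩ := hq
  obtain ⟨c, hc⟩ := hs.continuous
  obtain ⟨g, g', hg, g0, g1, e1, e2, e3⟩ :=
    HasSobolevDeriv.exists_cos_interpolation hℓ (c v₁) (c v₂)
  let U : Option E → ℝ → ℂ := fun e => e.elim g u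
  let U' : Option E → ℝ → ℂ := fun e => e.elim g' v
  have hU : (Γ.addEdge v₁ v₂ ℓ hℓ).IsSobolev U U' := by
    refine ⟨fun e => ?_, c, fun e => ?_⟩
    · cases e with
      | none => exact hg
      | some e => exact hs.deriv e
    · cases e with
      | none => exact ⟨g0, g1⟩
      | some e => exact hc e
  obtain ⟨f, hf⟩ := exists_represents fun e => (hU.deriv e).memLp
  obtain ⟨f', hf'⟩ := exists_represents fun e => (hU.deriv e).1
  refine ⟨(f, f'), ⟨U, U', hU, hf, hf'⟩, (c v₁ + c v₂) / 2, (c v₂ - c v₁) / 2, ?_, ?_, ?_⟩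
  · rw [hf.inner_one, Fintype.sum_option, ← e1]
    rw [hu.inner_one] at hmean
    simpa [U, addEdge] using hmean
  · rw [hf.norm_sq_eq, hu.norm_sq_eq, Fintype.sum_option, add_assoc, ← e2, add_comm]
    rfl
  · rw [hf'.norm_sq_eq, hv.norm_sq_eq, Fintype.sum_option, ← e3, add_comm]
    rfl

end MetricGraph

end

/-! ### Comparison of the two eigenvalues -/

theorem theorem4 {V E : Type*} [Finite V] [Fintype E] [Nonempty E] (Γ : MetricGraph V E)
    (hΓ : Γ.Connected) (v₁ v₂ : V) (ℓ : ℝ) (hℓ : 0 < ℓ) (h : Γ.totalLength < ℓ) :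
    ∃ μ μ' : ℝ, Γ.IsNthEigenvalue 1 μ ∧ (Γ.addEdge v₁ v₂ ℓ hℓ).IsNthEigenvalue 1 μ' ∧ μ' ≤ μ := by
  obtain ⟨μ, p, hp⟩ := Γ.exists_isGapMinimizer
  obtain ⟨μ', p', hp'⟩ := (Γ.addEdge v₁ v₂ ℓ hℓ).exists_isGapMinimizer
  refine ⟨μ, μ', hp.isNthEigenvalue_one, hp'.isNthEigenvalue_one, ?_⟩
  have hL : 0 < Γ.totalLength := MetricGraph.totalLength_pos
  have hp0 : 0 < ‖p.1‖ ^ 2 := by have := hp.ne_zero; positivity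
  have hκ : (Real.pi / ℓ) ^ 2 ≤ μ := by
    have h1 := hΓ.sq_mul_norm_sq_le (κ := Real.pi / ℓ) (by positivity) (by
      rw [div_mul_eq_mul_div, div_lt_iff₀ hℓ]
      exact mul_lt_mul_of_pos_left h Real.pi_pos) hp.mem hp.inner_one
    rw [hp.rayleigh] at h1
    exact le_of_mul_le_mul_right h1 hp0
  obtain ⟨r, hr, s, d, h1, h2, h3⟩ :=
    MetricGraph.exists_extension_addEdge v₁ v₂ hℓ hp.mem hp.inner_one
  have h4 := hp'.le_of_mem hr
  -- The squared norm lost by projecting off the constants on `Γ'` is at most the contribution `ℓ *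
  -- ‖s‖ ^ 2` of the constant part on the new edge.
  have h5 : ‖(ℓ : ℂ) * s‖ ^ 2 / (ℓ + Γ.totalLength) ≤ ℓ * ‖s‖ ^ 2 := by
    rw [norm_mul, Complex.norm_real, Real.norm_eq_abs, abs_of_pos hℓ, div_le_iff₀ (by positivity)]
    have : 0 ≤ ℓ * ‖s‖ ^ 2 * Γ.totalLength := by positivity
    nlinarith
  rw [h1, h2, h3, MetricGraph.totalLength_addEdge, hp.rayleigh] at h4
  have h6 : (Real.pi / ℓ) ^ 2 * (ℓ / 2 * ‖d‖ ^ 2) ≤ μ * (ℓ / 2 * ‖d‖ ^ 2) := by gcongr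
  -- The extended function is used in the Poincaré inequality of `Γ'`. Since `μ' ≥ 0`, the
  -- nonnegative remainder left by `h5` can be dropped, and `h6` replaces `(π / ℓ) ^ 2` by `μ`.
  have h7 : μ' * (‖p.1‖ ^ 2 + ℓ / 2 * ‖d‖ ^ 2) ≤ μ * (‖p.1‖ ^ 2 + ℓ / 2 * ‖d‖ ^ 2) := by
    have h8 : μ' * (‖p.1‖ ^ 2 + ℓ / 2 * ‖d‖ ^ 2) ≤ μ' * (‖p.1‖ ^ 2 + ℓ * ‖s‖ ^ 2 +
        ℓ / 2 * ‖d‖ ^ 2 - ‖(ℓ : ℂ) * s‖ ^ 2 / (ℓ + Γ.totalLength)) :=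
      mul_le_mul_of_nonneg_left (by linarith) hp'.nonneg
    linarith
  exact le_of_mul_le_mul_right h7 (by positivity)
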